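/- Let $d\ge 1$, $p\in\mathbb N_0$, and let $\Omega\subset\mathbb R^d$ be open and bounded (for instance a bounded Lipschitz domain). Let $0<\alpha\le\beta<\infty$ and let $\sigma,\kappa$ be real constants. Then there are constants $c,C>0$, depending only on $d,p,\Omega,\alpha,\beta,\sigma,\kappa$, such that the following holds. Let $A:\Omega\to\mathbb R$ be measurable with $\alpha\le A(x)\le\beta$ for a.e. $x\in\Omega$. Let $\mathcal T_H$ be a finite decomposition of $\Omega$ into closed axis-parallel $d$-rectangles $K=\prod_{i=1}^d[l_i,u_i]$ with $l_i<u_i$, that is, $\overline\Omega=\bigcup_{K\in\mathcal T_H}K$, the interiors of the elements lie in $\Omega$, and the interiors of distinct elements are disjoint. Assume that $\mathcal T_H$ is shape regular, $\operatorname{diam}K\le\sigma\min_i(u_i-l_i)$ for all $K\in\mathcal T_H$, and quasi-uniform with mesh size $H>0$, $\operatorname{diam}K\le H\le\kappa\operatorname{diam}K$ for all $K\in\mathcal T_H$. Let $V_H\subset L^2(\Omega)$ be the space of functions that on each $K\in\mathcal T_H$ agree with a polynomial of degree at most $p$ in each variable, let $\Pi_H$ be the $L^2(\Omega)$-orthogonal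 projection onto $V_H$, and let $$W=\{w\in H^1_0(\Omega):\Pi_Hw=0\},\qquad a(u,w)=\int_\Omega A\,\nabla u\cdot\nabla w\,dx.$$ For $S\subset\mathbb R^d$ let $\mathtt N(S)=\bigcup\{K\in\mathcal T_H: \overline S\cap K\ne\emptyset\}$, and let $\mathtt N^1(S)=\mathtt N(S)$ and $\mathtt N^{\lambda}(S)=\mathtt N(\mathtt N^{\lambda-1}(S))$ for $\lambda\ge2$. Then for every $G\in\mathcal T_H$ and $v\in L^2(\Omega)$ there is a unique $\mathcal D_Gv\in W$ (the global element-wise enriched correction) with $$a(\mathcal D_Gv,w)=-(v,w)_{L^2(G)}\qquad\text{for all }w\in W,$$ and it satisfies, for every integer $\lambda\ge1$, $$\|\nabla\mathcal D_Gv\|_{L^2(\Omega\setminus\mathtt N^{\lambda}(G))}\le C\,e^{-c\lambda}\,\|\nabla\mathcal D_Gv\|_{L^2(\Omega)}.$$ In particular, $c$ and $C$ do not depend on $H$, $\lambda$, $\mathcal T_H$, $G$, $v$, or on $A$ other than through $\alpha$ and $\beta$. -/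

import Mathlib

open MeasureTheory Set
open scoped ContDiff Gradient

namespace LOD

/-! ### Meshes of `d`-rectangles -/

/-- A nondegenerate axis-parallel `d`-rectangle `∏ i, [lower i, upper i]`. -/
structure Rect (d : ℕ) where
  lower : Fin d → ℝ
  upper : Fin d → ℝ
  lower_lt_upper : ∀ i, lower i < upper i

/-- The closed `d`-rectangle as a set of points. -/
def Rect.closed {d : ℕ} (K : Rect d) : Set (EuclideanSpace ℝ (Fin d)) :=
  {x | ∀ i, x i ∈ Icc (K.lower i) (K.upper i)}

/-- The interior of the `d`-rectangle. -/
def Rect.inner {d : ℕ} (K : Rect d) : Set (EuclideanSpace ℝ (Fin d)) :=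
  {x | ∀ i, x i ∈ Ioo (K.lower i) (K.upper i)}

/-- A decomposition of `Ω` into finitely many closed `d`-rectangles: they cover the closure of
`Ω`, their interiors lie in `Ω`, and the interiors of distinct elements are disjoint. -/
structure RectMesh {d : ℕ} (Ω : Set (EuclideanSpace ℝ (Fin d))) where
  cells : Finset (Rect d)
  closure_eq : closure Ω = ⋃ K ∈ cells, K.closed
  inner_subset : ∀ K ∈ cells, K.inner ⊆ Ω
  inner_disjoint : ∀ K ∈ cells, ∀ L ∈ cells, K ≠ L → Disjoint K.inner L.inner

/-- Shape regularity with constant `σ`: the diameter of each element is at most `σ` times the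
diameter of its largest inscribed ball, that is, `σ` times each of its side lengths. -/
def RectMesh.ShapeRegular {d : ℕ} {Ω : Set (EuclideanSpace ℝ (Fin d))} (T : RectMesh Ω)
    (σ : ℝ) : Prop :=
  ∀ K ∈ T.cells, ∀ i, Metric.diam K.closed ≤ σ * (K.upper i - K.lower i)

/-- Quasi-uniformity with constant `κ` and mesh size `H`: all diameters lie in `[H / κ, H]`. -/
def RectMesh.QuasiUniform {d : ℕ} {Ω : Set (EuclideanSpace ℝ (Fin d))} (T : RectMesh Ω)
    (κ H : ℝ) : Prop :=
  ∀ K ∈ T.cells, Metric.diam K.closed ≤ H ∧ H ≤ κ * Metric.diam K.closed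

/-- The first-order patch `N(S)`: the union of all elements that touch the closure of `S`. -/
def RectMesh.nbhd {d : ℕ} {Ω : Set (EuclideanSpace ℝ (Fin d))} (T : RectMesh Ω)
    (S : Set (EuclideanSpace ℝ (Fin d))) : Set (EuclideanSpace ℝ (Fin d)) :=
  ⋃ K ∈ {K | K ∈ T.cells ∧ (closure S ∩ K.closed).Nonempty}, K.closed

/-- The patch `N^k(S)` of order `k`: the `k`-fold iterate of `S ↦ N(S)`. -/
def RectMesh.patch {d : ℕ} {Ω : Set (EuclideanSpace ℝ (Fin d))} (T : RectMesh Ω)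
    (k : ℕ) (S : Set (EuclideanSpace ℝ (Fin d))) : Set (EuclideanSpace ℝ (Fin d)) :=
  T.nbhd^[k] S

/-! ### Function spaces -/

/-- `L²(Ω)`. -/
abbrev L2 {d : ℕ} (Ω : Set (EuclideanSpace ℝ (Fin d))) : Type :=
  Lp ℝ 2 (volume.restrict Ω)

/-- Pairs (function, vector field) in `L²(Ω) × L²(Ω)^d` with the Hilbert norm
`(‖u‖² + ‖g‖²)^(1/2)`; a Sobolev function is represented by its pair `(u, ∇u)`. -/
abbrev L2Pair {d : ℕ} (Ω : Set (EuclideanSpace ℝ (Fin d))) : Type :=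
  WithLp 2 (L2 Ω × Lp (EuclideanSpace ℝ (Fin d)) 2 (volume.restrict Ω))

/-- The pairs `(φ, ∇φ)` with `φ` a smooth function compactly supported in `Ω`. -/
noncomputable def testPairs {d : ℕ} (Ω : Set (EuclideanSpace ℝ (Fin d))) : Submodule ℝ (L2Pair Ω) where
  carrier := {z | ∃ φ : EuclideanSpace ℝ (Fin d) → ℝ,
    ContDiff ℝ ∞ φ ∧ HasCompactSupport φ ∧ tsupport φ ⊆ Ω ∧
    z.fst =ᵐ[volume.restrict Ω] φ ∧ z.snd =ᵐ[volume.restrict Ω] ∇ φ}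
  zero_mem' := by
    refine ⟨fun _ => 0, contDiff_const, HasCompactSupport.zero, ?_, ?_, ?_⟩
    · have h : tsupport (fun _ : EuclideanSpace ℝ (Fin d) => (0 : ℝ)) = ∅ := by
        simp [tsupport]
      simp [h]
    · exact Lp.coeFn_zero _ _ _
    · rw [gradient_fun_const']
      exact Lp.coeFn_zero _ _ _
  add_mem' := by
    rintro z w ⟨φ, hφ, hφc, hφs, h1, h2⟩ ⟨ψ, hψ, hψc, hψs, h3, h4⟩
    refine ⟨φ + ψ, hφ.add hψ, hφc.add hψc, ?_, ?_, ?_⟩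
    · exact (tsupport_add φ ψ).trans (union_subset hφs hψs)
    · exact (Lp.coeFn_add _ _).trans (h1.add h3)
    · have hg : ∇ (φ + ψ) = ∇ φ + ∇ ψ := by
        funext x
        have e1 : DifferentiableAt ℝ φ x := (hφ.differentiable (by simp)).differentiableAt
        have e2 : DifferentiableAt ℝ ψ x := (hψ.differentiable (by simp)).differentiableAt
        simp [gradient, fderiv_add e1 e2]
      rw [hg]
      exact (Lp.coeFn_add _ _).trans (h2.add h4)
  smul_mem' := by
    rintro c z ⟨φ, hφ, hφc, hφs, h1, h2⟩
    refine ⟨c • φ, hφ.const_smul c, hφc.smul_left (f := fun _ => c), ?_, ?_, ?_⟩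
    · exact (closure_mono (Function.support_const_smul_subset c φ)).trans hφs
    · exact (Lp.coeFn_smul _ _).trans (h1.const_smul c)
    · have hg : ∇ (c • φ) = c • ∇ φ := by
        funext x
        have e1 : DifferentiableAt ℝ φ x := (hφ.differentiable (by simp)).differentiableAt
        simp [gradient, fderiv_const_smul e1]
      rw [hg]
      exact (Lp.coeFn_smul _ _).trans (h2.const_smul c)

/-- `H¹₀(Ω)`, the closure of the test functions in the `H¹`-norm. An element `u` consists of the
function `u.fst` and its weak gradient `u.snd`. -/
noncomputable def H10 {d : ℕ} (Ω : Set (EuclideanSpace ℝ (Fin d))) : Submodule ℝ (L2Pair Ω) :=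
  (testPairs Ω).topologicalClosure

/-- `V_H`: the functions in `L²(Ω)` that on each element agree with a polynomial of degree at
most `p` in each variable. -/
noncomputable def RectMesh.polySpace {d : ℕ} {Ω : Set (EuclideanSpace ℝ (Fin d))} (T : RectMesh Ω) (p : ℕ) :
    Submodule ℝ (L2 Ω) where
  carrier := {v | ∀ K ∈ T.cells, ∃ q ∈ MvPolynomial.restrictDegree (Fin d) ℝ p,
    v =ᵐ[(volume.restrict Ω).restrict K.closed] fun x => MvPolynomial.eval (fun i => x i) q}
  zero_mem' := fun K _ => ⟨0, zero_mem _, by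
    filter_upwards [ae_restrict_of_ae (Lp.coeFn_zero ℝ 2 (volume.restrict Ω))] with x hx
    rw [hx]
    simp⟩
  add_mem' := by
    intro v w hv hw K hK
    obtain ⟨q, hq, h1⟩ := hv K hK
    obtain ⟨r, hr, h2⟩ := hw K hK
    refine ⟨q + r, add_mem hq hr, ?_⟩
    filter_upwards [ae_restrict_of_ae (Lp.coeFn_add v w), h1, h2] with x hx h1 h2
    rw [hx, Pi.add_apply, h1, h2, map_add]
  smul_mem' := by
    intro c v hv K hK
    obtain ⟨q, hq, h1⟩ := hv K hK
    refine ⟨c • q, Submodule.smul_mem _ _ hq, ?_⟩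
    filter_upwards [ae_restrict_of_ae (Lp.coeFn_smul c v), h1] with x hx h1
    rw [hx, Pi.smul_apply, h1, MvPolynomial.smul_eval, smul_eq_mul]

theorem aestronglyMeasurable_eval {d : ℕ} (μ : Measure (EuclideanSpace ℝ (Fin d)))
    (q : MvPolynomial (Fin d) ℝ) : AEStronglyMeasurable
      (fun x : EuclideanSpace ℝ (Fin d) => MvPolynomial.eval (fun i => x i) q) μ := by
  have h : Continuous fun x : EuclideanSpace ℝ (Fin d) => MvPolynomial.eval (fun i => x i) q :=
    (MvPolynomial.continuous_eval q).comp (by fun_prop)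
  exact h.aestronglyMeasurable

/-- Evaluation of polynomials, as a linear map into classes of a.e. equal functions. -/
noncomputable def polyToAE {d : ℕ} (μ : Measure (EuclideanSpace ℝ (Fin d))) :
    MvPolynomial (Fin d) ℝ →ₗ[ℝ] (EuclideanSpace ℝ (Fin d) →ₘ[μ] ℝ) where
  toFun q := AEEqFun.mk (fun x => MvPolynomial.eval (fun i => x i) q)
    (aestronglyMeasurable_eval μ q)
  map_add' q r := by
    rw [AEEqFun.mk_add_mk]
    congr 1
    funext x
    simp
  map_smul' c q := by
    rw [RingHom.id_apply]
    refine Eq.trans ?_ (AEEqFun.smul_mk c _ (aestronglyMeasurable_eval μ q))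
    congr 1
    funext x
    simp

instance RectMesh.finiteDimensional_polySpace {d : ℕ} {Ω : Set (EuclideanSpace ℝ (Fin d))}
    (T : RectMesh Ω) (p : ℕ) : FiniteDimensional ℝ (T.polySpace p) := by
  classical
  let J : L2 Ω →ₗ[ℝ] (K : T.cells) →
      (EuclideanSpace ℝ (Fin d) →ₘ[(volume.restrict Ω).restrict K.1.closed] ℝ) :=
    LinearMap.pi fun K =>
      (Lp.LpSubmodule ℝ ℝ 2 ((volume.restrict Ω).restrict K.1.closed)).subtype.comp
        (LpToLpRestrictCLM (EuclideanSpace ℝ (Fin d)) ℝ ℝ (volume.restrict Ω) 2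
          K.1.closed).toLinearMap
  have hJval : ∀ v K, J v K =ᵐ[(volume.restrict Ω).restrict K.1.closed] v :=
    fun v K => LpToLpRestrictCLM_coeFn ℝ K.1.closed v
  have hJ : Function.Injective J := by
    rw [← LinearMap.ker_eq_bot, LinearMap.ker_eq_bot']
    intro v hv
    apply Lp.ext
    refine Filter.EventuallyEq.trans ?_ (Lp.coeFn_zero ℝ 2 (volume.restrict Ω)).symm
    have h1 : ∀ K ∈ (T.cells : Set (Rect d)),
        ∀ᵐ x ∂(volume.restrict Ω).restrict K.closed, v x = 0 := by
      intro K hK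
      have h2 := hJval v ⟨K, hK⟩
      rw [hv] at h2
      filter_upwards [h2, AEEqFun.coeFn_zero (β := ℝ)
        (μ := (volume.restrict Ω).restrict K.closed)] with x hx hx'
      rw [← hx]
      exact hx'
    replace h1 := (ae_restrict_biUnion_finset_iff (μ := volume.restrict Ω)
      (fun K : Rect d => K.closed) T.cells (fun x => v x = 0)).2 h1
    have h3 : Ω ⊆ ⋃ K ∈ T.cells, K.closed := T.closure_eq ▸ subset_closure
    have h4 := ae_mono (Measure.restrict_mono_set (volume.restrict Ω) h3) h1
    rw [Measure.restrict_restrict_of_subset subset_rfl] at h4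
    exact h4
  let Φ : ((K : T.cells) → MvPolynomial.restrictDegree (Fin d) ℝ p) →ₗ[ℝ] (K : T.cells) →
      (EuclideanSpace ℝ (Fin d) →ₘ[(volume.restrict Ω).restrict K.1.closed] ℝ) :=
    LinearMap.pi fun K => (polyToAE _).comp
      ((MvPolynomial.restrictDegree (Fin d) ℝ p).subtype.comp (LinearMap.proj K))
  have hle : (T.polySpace p).map J ≤ LinearMap.range Φ := by
    rintro _ ⟨v, hv, rfl⟩
    choose q hq hqv using hv
    refine ⟨fun K => ⟨q K.1 K.2, hq K.1 K.2⟩, ?_⟩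
    funext K
    apply AEEqFun.ext
    exact (AEEqFun.coeFn_mk _ _).trans ((hqv K.1 K.2).symm.trans (hJval v K).symm)
  have : FiniteDimensional ℝ ((T.polySpace p).map J) := Submodule.finiteDimensional_of_le hle
  exact (Submodule.equivMapOfInjective J hJ (T.polySpace p)).symm.finiteDimensional

/-- The `L²`-orthogonal projection onto `V_H`. -/
noncomputable def RectMesh.l2Proj {d : ℕ} {Ω : Set (EuclideanSpace ℝ (Fin d))} (T : RectMesh Ω)
    (p : ℕ) : L2 Ω →L[ℝ] L2 Ω :=
  (T.polySpace p).starProjection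

/-- `W`: the functions in `H¹₀(Ω)` whose `L²`-projection onto `V_H` vanishes. -/
noncomputable def RectMesh.kernelSpace {d : ℕ} {Ω : Set (EuclideanSpace ℝ (Fin d))}
    (T : RectMesh Ω) (p : ℕ) : Submodule ℝ (L2Pair Ω) :=
  H10 Ω ⊓ (LinearMap.ker (T.l2Proj p).toLinearMap).comap (WithLp.fstₗ 2 ℝ _ _)

/-! ### The enriched corrector -/

/-- `a(u, w) = ∫_Ω A ∇u · ∇w`. -/
noncomputable def energyForm {d : ℕ} {Ω : Set (EuclideanSpace ℝ (Fin d))}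
    (A : EuclideanSpace ℝ (Fin d) → ℝ) (u w : L2Pair Ω) : ℝ :=
  ∫ x in Ω, A x * inner ℝ (u.snd x) (w.snd x)

/-- `ψ` is the enriched correction `D_G v` : `ψ ∈ W` and `a(ψ, w) = -(v, w)_{L²(G)}` for all
`w ∈ W`. -/
def RectMesh.IsEnrichedCorrection {d : ℕ} {Ω : Set (EuclideanSpace ℝ (Fin d))} (T : RectMesh Ω)
    (p : ℕ) (A : EuclideanSpace ℝ (Fin d) → ℝ) (G : Rect d) (v : L2 Ω) (ψ : L2Pair Ω) : Prop :=
  ψ ∈ T.kernelSpace p ∧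
    ∀ w ∈ T.kernelSpace p, energyForm A ψ w = -∫ x in Ω ∩ G.closed, v x * w.fst x

/-- `‖∇u‖_{L²(S)}` for a measurable `S ⊆ Ω`. -/
noncomputable def gradNormOn {d : ℕ} {Ω : Set (EuclideanSpace ℝ (Fin d))}
    (S : Set (EuclideanSpace ℝ (Fin d))) (u : L2Pair Ω) : ℝ :=
  Real.sqrt (∫ x in S, ‖u.snd x‖ ^ 2)

end LOD

namespace LOD

variable {d : ℕ} {Ω : Set (EuclideanSpace ℝ (Fin d))}

/-! ### Rectangles -/

/-! The proof is a Caccioppoli argument that removes a fixed fraction of the energy with each block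
of layers. Let `ψ` be the corrector, `S` the cells of some patch of `G`, and `S'` the cells reached
from `S` by `r = 2 * 2 ^ d + 2` further neighbourhood steps. Take a smooth `η` that vanishes on `S`,
equals one on every cell outside `S'`, and has slope of order `1 / H`. The product `η ψ` is not in
`W`, but `V_H` is discontinuous across cells, so membership in `W` is a family of moment conditions,
one cell at a time. Subtracting from `η ψ` bubble functions on the cells of `S' \ S` restores those
conditions and gives a test function `w` in `W`.

Since `w` vanishes on `G`, `a(ψ, w) = 0`. Cells outside `S'` contribute at least `α` times their
energy. Cells of `S' \ S` contribute at most `β Q` times theirs in absolute value: `ψ` has mean zero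
on each cell, so Poincaré's inequality supplies a factor `H` that cancels the `1 / H` in `∇ η` and
in the bubbles. With `E` the energy off a set of cells this reads `α E(S') ≤ β Q (E(S) - E(S'))`,
hence `E(S') ≤ q E(S)` with `q = β Q / (α + β Q) < 1`. Iteration gives exponential decay. The key
lemmas are `exists_cutoff_kernelSpace`, `RectMesh.energyOff_step` and `exists_contraction`.

The geometric difficulty is that meshes may have hanging nodes and `Ω` need not be Lipschitz, so
Euclidean closeness has to be converted into a bounded number of layers. One mesh `T₀` of `Ω`, fixed
once and for all, does this: its non-touching cells are at a distance at least some `δ > 0`, so two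
points of `closure Ω` closer than `δ` are joined inside `closure Ω` by two segments that stay in
their coordinate box. If the cells of the given mesh are wider than that box, a count of box corners
bounds the number of layers the path crosses. The domain enters the decay constants only through `δ`
and its diameter. -/

theorem Rect.inner_subset_closed (K : Rect d) : K.inner ⊆ K.closed :=
  fun _ hx i => Ioo_subset_Icc_self (hx i)

theorem Rect.closed_eq_preimage (K : Rect d) :
    K.closed = (WithLp.ofLp : EuclideanSpace ℝ (Fin d) → Fin d → ℝ) ⁻¹'
      (univ.pi fun i => Icc (K.lower i) (K.upper i)) := by
  ext x; simp only [Rect.closed, mem_ofPred_eq, mem_preimage, Set.mem_pi, mem_univ, true_implies]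

theorem Rect.inner_eq_preimage (K : Rect d) :
    K.inner = (WithLp.ofLp : EuclideanSpace ℝ (Fin d) → Fin d → ℝ) ⁻¹'
      (univ.pi fun i => Ioo (K.lower i) (K.upper i)) := by
  ext x; simp only [Rect.inner, mem_ofPred_eq, mem_preimage, Set.mem_pi, mem_univ, true_implies]

theorem Rect.isClosed_closed (K : Rect d) : IsClosed K.closed := by
  rw [K.closed_eq_preimage]
  exact (isClosed_set_pi fun i _ => isClosed_Icc).preimage (PiLp.continuous_ofLp 2 _)

theorem Rect.isOpen_inner (K : Rect d) : IsOpen K.inner := by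
  rw [K.inner_eq_preimage]
  exact (isOpen_set_pi finite_univ fun i _ => isOpen_Ioo).preimage (PiLp.continuous_ofLp 2 _)

theorem Rect.isCompact_closed (K : Rect d) : IsCompact K.closed := by
  have h : IsCompact (univ.pi fun i => Icc (K.lower i) (K.upper i)) :=
    isCompact_univ_pi fun i => isCompact_Icc
  have h2 := h.image (PiLp.continuous_toLp 2 (fun _ : Fin d => ℝ))
  convert h2 using 1
  ext x
  constructor
  · intro hx
    exact ⟨WithLp.ofLp x, fun i _ => hx i, rfl⟩
  · rintro ⟨y, hy, rfl⟩ i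
    exact hy i (mem_univ i)

theorem Rect.convex_inner (K : Rect d) : Convex ℝ K.inner := by
  intro x hx y hy a b ha hb hab i
  have := convex_Ioo (K.lower i) (K.upper i) (hx i) (hy i) ha hb hab
  simpa using this

theorem Rect.convex_closed (K : Rect d) : Convex ℝ K.closed := by
  intro x hx y hy a b ha hb hab i
  have := convex_Icc (K.lower i) (K.upper i) (hx i) (hy i) ha hb hab
  simpa using this

theorem Rect.inner_nonempty (K : Rect d) : K.inner.Nonempty :=
  ⟨WithLp.toLp 2 fun i => (K.lower i + K.upper i) / 2, fun i =>
    ⟨by have := K.lower_lt_upper i; simp only; linarith,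
     by have := K.lower_lt_upper i; simp only; linarith⟩⟩

theorem Rect.closed_nonempty (K : Rect d) : K.closed.Nonempty :=
  K.inner_nonempty.mono K.inner_subset_closed

theorem Rect.inner_ae_eq_closed (K : Rect d) : K.inner =ᵐ[volume] K.closed := by
  rw [K.closed_eq_preimage, K.inner_eq_preimage, pi_univ_Icc]
  exact (PiLp.volume_preserving_ofLp (Fin d)).quasiMeasurePreserving.preimage_ae_eq
    Measure.univ_pi_Ioo_ae_eq_Icc

theorem Rect.volume_inner_pos (K : Rect d) : 0 < volume K.inner :=
  K.isOpen_inner.measure_pos _ K.inner_nonempty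

theorem Rect.volume_inner_lt_top (K : Rect d) : volume K.inner < ⊤ :=
  (measure_mono K.inner_subset_closed).trans_lt K.isCompact_closed.measure_lt_top

theorem Rect.volume_real_inner_pos (K : Rect d) : 0 < volume.real K.inner :=
  ENNReal.toReal_pos K.volume_inner_pos.ne' K.volume_inner_lt_top.ne

theorem Rect.side_le_diam (K : Rect d) (i : Fin d) :
    K.upper i - K.lower i ≤ Metric.diam K.closed := by
  have h1 : WithLp.toLp 2 K.lower ∈ K.closed :=
    fun j => left_mem_Icc.2 (K.lower_lt_upper j).le
  have h2 : WithLp.toLp 2 K.upper ∈ K.closed :=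
    fun j => right_mem_Icc.2 (K.lower_lt_upper j).le
  have h3 := Metric.dist_le_diam_of_mem K.isCompact_closed.isBounded h2 h1
  refine le_trans ?_ h3
  rw [dist_eq_norm]
  refine le_trans ?_ (PiLp.norm_apply_le _ i)
  simp [Real.norm_eq_abs, le_abs_self]

/-! ### The mesh as a partition of the measure -/

/-- Faces of rectangles are null sets, so the open cells exhaust `Ω` up to measure zero. All later
integrals and almost-everywhere statements are split over open cells in this way. -/
theorem RectMesh.volume_restrict_eq_sum (T : RectMesh Ω) :
    volume.restrict Ω = ∑ K ∈ T.cells, volume.restrict K.inner := by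
  have h1 : (⋃ K ∈ T.cells, K.inner) =ᵐ[volume] Ω := by
    apply Filter.EventuallyLE.antisymm
    · exact LE.le.eventuallyLE (iUnion₂_subset T.inner_subset)
    · have h2 : (⋃ K ∈ T.cells, K.inner) =ᵐ[volume] ⋃ K ∈ T.cells, K.closed :=
        Filter.EventuallyEq.countable_bUnion T.cells.countable_toSet
          fun K _ => K.inner_ae_eq_closed
      have h3 : Ω ⊆ ⋃ K ∈ T.cells, K.closed := T.closure_eq ▸ subset_closure
      exact (LE.le.eventuallyLE h3).trans h2.symm.le
  rw [← Measure.restrict_congr_set h1]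
  have h4 : ∀ S ⊆ T.cells, volume.restrict (⋃ K ∈ S, K.inner)
      = ∑ K ∈ S, volume.restrict K.inner := by
    classical
    intro S
    induction S using Finset.induction_on with
    | empty => simp
    | insert K S hK ih =>
      intro hS
      rw [Finset.insert_subset_iff] at hS
      rw [Finset.sum_insert hK, Finset.set_biUnion_insert, Measure.restrict_union, ih hS.2]
      · rw [disjoint_iUnion₂_right]
        intro L hL
        exact T.inner_disjoint K hS.1 L (hS.2 hL) fun h => hK (h ▸ hL)
      · exact S.measurableSet_biUnion fun L _ => L.isOpen_inner.measurableSet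
  exact h4 _ subset_rfl

theorem RectMesh.restrict_inner_le (T : RectMesh Ω) {K : Rect d} (hK : K ∈ T.cells) :
    volume.restrict K.inner ≤ volume.restrict Ω :=
  Measure.restrict_mono_set _ (T.inner_subset K hK)

theorem RectMesh.integral_eq_sum (T : RectMesh Ω) {f : EuclideanSpace ℝ (Fin d) → ℝ}
    (hf : Integrable f (volume.restrict Ω)) :
    ∫ x in Ω, f x = ∑ K ∈ T.cells, ∫ x in K.inner, f x := by
  rw [T.volume_restrict_eq_sum]
  exact integral_finsetSum_measure fun K hK => hf.mono_measure (T.restrict_inner_le hK)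

theorem RectMesh.inter_closed_ae_eq (T : RectMesh Ω) {K : Rect d} (hK : K ∈ T.cells) :
    (Ω ∩ K.closed : Set _) =ᵐ[volume] K.inner := by
  have h := (Filter.EventuallyEq.refl (ae volume) Ω).inter K.inner_ae_eq_closed.symm
  rwa [inter_eq_right.2 (T.inner_subset K hK)] at h

/-! ### Layers of cells -/

/-- The union of a finite set of closed cells. -/
def cellUnion (S : Finset (Rect d)) : Set (EuclideanSpace ℝ (Fin d)) := ⋃ K ∈ S, K.closed

theorem isClosed_cellUnion (S : Finset (Rect d)) : IsClosed (cellUnion S) :=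
  S.finite_toSet.isClosed_biUnion fun K _ => K.isClosed_closed

theorem mem_cellUnion {S : Finset (Rect d)} {x : EuclideanSpace ℝ (Fin d)} :
    x ∈ cellUnion S ↔ ∃ K ∈ S, x ∈ K.closed := by simp [cellUnion]

open Classical in
/-- The cells that touch one of the cells in `S`. -/
noncomputable def RectMesh.grow (T : RectMesh Ω) (S : Finset (Rect d)) : Finset (Rect d) :=
  T.cells.filter fun K => (cellUnion S ∩ K.closed).Nonempty

theorem RectMesh.mem_grow (T : RectMesh Ω) {S : Finset (Rect d)} {K : Rect d} :
    K ∈ T.grow S ↔ K ∈ T.cells ∧ (cellUnion S ∩ K.closed).Nonempty := by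
  simp [RectMesh.grow]

theorem RectMesh.grow_subset_cells (T : RectMesh Ω) (S : Finset (Rect d)) :
    T.grow S ⊆ T.cells := fun _ hK => (T.mem_grow.1 hK).1

theorem RectMesh.subset_grow (T : RectMesh Ω) {S : Finset (Rect d)} (hS : S ⊆ T.cells) :
    S ⊆ T.grow S := fun K hK => by
  obtain ⟨x, hx⟩ := K.closed_nonempty
  exact T.mem_grow.2 ⟨hS hK, x, mem_cellUnion.2 ⟨K, hK, hx⟩, hx⟩

theorem RectMesh.iterate_grow_subset_cells (T : RectMesh Ω) {S : Finset (Rect d)}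
    (hS : S ⊆ T.cells) (n : ℕ) : T.grow^[n] S ⊆ T.cells := by
  cases n with
  | zero => exact hS
  | succ n => rw [Function.iterate_succ_apply']; exact T.grow_subset_cells _

theorem RectMesh.subset_iterate_grow (T : RectMesh Ω) {S : Finset (Rect d)}
    (hS : S ⊆ T.cells) (n : ℕ) : S ⊆ T.grow^[n] S := by
  induction n with
  | zero => exact subset_rfl
  | succ n ih =>
    rw [Function.iterate_succ_apply']
    exact ih.trans (T.subset_grow (T.iterate_grow_subset_cells hS n))

/-- Passes from patches as point sets to finite sets of cells; the closure in `nbhd` is harmless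
because finite unions of closed cells are closed. -/
theorem RectMesh.patch_eq (T : RectMesh Ω) (G : Rect d) (k : ℕ) :
    T.patch k G.closed = cellUnion (T.grow^[k] {G}) := by
  induction k with
  | zero => simp [RectMesh.patch, cellUnion]
  | succ k ih =>
    have h : T.patch (k + 1) G.closed = T.nbhd (T.patch k G.closed) :=
      Function.iterate_succ_apply' _ _ _
    rw [h, ih, Function.iterate_succ_apply']
    ext x
    simp [RectMesh.nbhd, mem_cellUnion, T.mem_grow, (isClosed_cellUnion _).closure_eq, and_assoc]

/-- A connected set inside a cube smaller than every cell is covered after boundedly many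
neighbourhood steps: cells meeting the cube share one of its `2 ^ d` corners with all other cells
of the same type. -/
theorem RectMesh.subset_iterate_grow_of_isPreconnected (T : RectMesh Ω)
    {s : Set (EuclideanSpace ℝ (Fin d))} (hs : IsPreconnected s) (hsΩ : s ⊆ closure Ω)
    {h : ℝ} (hT : ∀ K ∈ T.cells, ∀ i, h ≤ K.upper i - K.lower i)
    {a b : Fin d → ℝ} (hab : ∀ i, b i - a i < h) (hsab : ∀ x ∈ s, ∀ i, x i ∈ Icc (a i) (b i))
    {S : Finset (Rect d)} (hS : S ⊆ T.cells) (hne : (s ∩ cellUnion S).Nonempty) :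
    s ⊆ cellUnion (T.grow^[2 * 2 ^ d + 1] S) := by
  classical
  -- The label of a cell records the directions in which it reaches the upper face of the box. A
  -- cell meeting the box is wider than the box, so in every other direction it contains the lower
  -- coordinate, and the label singles out a corner lying in the cell.
  let lab : Rect d → Finset (Fin d) := fun K => Finset.univ.filter fun i => b i ≤ K.upper i
  let B : Finset (Rect d) → Finset (Finset (Fin d)) := fun S =>
    (S.filter fun K => (s ∩ K.closed).Nonempty).image lab
  have hcorner : ∀ K ∈ T.cells, (s ∩ K.closed).Nonempty →
      (WithLp.toLp 2 fun i => if i ∈ lab K then b i else a i) ∈ K.closed := by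
    rintro K hK ⟨x, hxs, hxK⟩ i
    have h1 := hsab x hxs i
    have h2 := hxK i
    have h3 := hT K hK i
    have h4 := hab i
    simp only [lab, Finset.mem_filter, Finset.mem_univ, true_and, mem_Icc] at *
    split_ifs with hi
    · exact ⟨by linarith, hi⟩
    · push Not at hi
      exact ⟨by linarith, by linarith⟩
  -- By connectedness, some cell `L` outside `grow S` meets `s` at a point of `grow S`. Its label is
  -- new: sharing a label with a cell of `S` means sharing a corner, which would place `L` in `grow
  -- S` already.
  have hstep : ∀ S ⊆ T.cells, (s ∩ cellUnion S).Nonempty → ¬ s ⊆ cellUnion (T.grow S) →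
      (B S).card < (B (T.grow (T.grow S))).card := by
    intro S hS hne hns
    have hgc := T.grow_subset_cells S
    obtain ⟨x, hxs, hx⟩ := not_subset.1 hns
    obtain ⟨y, hys, hy⟩ := hne
    have hcov : s ⊆ cellUnion (T.grow S) ∪ cellUnion (T.cells \ T.grow S) := by
      intro z hz
      have h1 := hsΩ hz
      rw [T.closure_eq] at h1
      obtain ⟨K, hK, hzK⟩ := mem_cellUnion.1 h1
      by_cases hKg : K ∈ T.grow S
      · exact Or.inl (mem_cellUnion.2 ⟨K, hKg, hzK⟩)
      · exact Or.inr (mem_cellUnion.2 ⟨K, Finset.mem_sdiff.2 ⟨hK, hKg⟩, hzK⟩)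
    have hy' : y ∈ cellUnion (T.grow S) := by
      obtain ⟨K, hK, hyK⟩ := mem_cellUnion.1 hy
      exact mem_cellUnion.2 ⟨K, T.subset_grow hS hK, hyK⟩
    obtain ⟨z, hzs, hz1, hz2⟩ := isPreconnected_closed_iff.1 hs _ _ (isClosed_cellUnion _)
      (isClosed_cellUnion _) hcov ⟨y, hys, hy'⟩ ⟨x, hxs, (hcov hxs).resolve_left hx⟩
    obtain ⟨L, hL, hzL⟩ := mem_cellUnion.1 hz2
    rw [Finset.mem_sdiff] at hL
    have hL2 : L ∈ T.grow (T.grow S) := T.mem_grow.2 ⟨hL.1, z, hz1, hzL⟩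
    apply Finset.card_lt_card
    rw [Finset.ssubset_iff_of_subset]
    · refine ⟨lab L, Finset.mem_image_of_mem _ (Finset.mem_filter.2 ⟨hL2, z, hzs, hzL⟩), ?_⟩
      intro hmem
      obtain ⟨K, hK, hKL⟩ := Finset.mem_image.1 hmem
      rw [Finset.mem_filter] at hK
      have h1 := hcorner K (hS hK.1) hK.2
      have h2 := hcorner L hL.1 ⟨z, hzs, hzL⟩
      rw [← hKL] at h2
      exact hL.2 (T.mem_grow.2 ⟨hL.1, _, mem_cellUnion.2 ⟨K, hK.1, h1⟩, h2⟩)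
    · apply Finset.image_subset_image
      intro K hK
      rw [Finset.mem_filter] at hK ⊢
      exact ⟨T.subset_grow hgc (T.subset_grow hS hK.1), hK.2⟩
  by_contra hns
  have hmono : ∀ n, T.grow^[n] S ⊆ T.grow^[n + 1] S := fun n => by
    rw [Function.iterate_succ_apply']
    exact T.subset_grow (T.iterate_grow_subset_cells hS n)
  have hmono2 : Monotone fun n => T.grow^[n] S := monotone_nat_of_le_succ hmono
  have hU : ∀ n, n ≤ 2 * 2 ^ d + 1 → ¬ s ⊆ cellUnion (T.grow^[n] S) := fun n hn h =>
    hns (h.trans (biUnion_subset_biUnion_left (hmono2 hn)))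
  -- Each double step adds a label as long as `s` is uncovered, and only `2 ^ d` labels exist, so `j
  -- = 2 ^ d + 1` is contradictory.
  have hcard : ∀ j, j ≤ 2 ^ d + 1 → j ≤ (B (T.grow^[2 * j] S)).card := by
    intro j
    induction j with
    | zero => simp
    | succ j ih =>
      intro hj
      have h1 := ih (by omega)
      have h2 := hstep (T.grow^[2 * j] S) (T.iterate_grow_subset_cells hS _)
        (hne.mono (inter_subset_inter_right _
          (biUnion_subset_biUnion_left (T.subset_iterate_grow hS _)))) (by
            rw [← Function.iterate_succ_apply' T.grow]
            exact hU _ (by omega))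
      rw [← Function.iterate_succ_apply' T.grow, ← Function.iterate_succ_apply' T.grow] at h2
      have h3 : 2 * (j + 1) = (2 * j).succ.succ := by omega
      rw [h3]
      omega
  have h1 := hcard (2 ^ d + 1) le_rfl
  have h2 := (B (T.grow^[2 * (2 ^ d + 1)] S)).card_le_univ
  simp only [Fintype.card_finset, Fintype.card_fin] at h2
  omega

/-- Helly's theorem on the line, in each coordinate: the intervals of `K`, of `L`, and between `x i`
and `y i` meet pairwise, hence have a common point. -/
theorem Rect.exists_mem_inter_between {K L : Rect d} (hKL : (K.closed ∩ L.closed).Nonempty)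
    {x y : EuclideanSpace ℝ (Fin d)} (hx : x ∈ K.closed) (hy : y ∈ L.closed) :
    ∃ z ∈ K.closed ∩ L.closed, ∀ i, z i ∈ Icc (min (x i) (y i)) (max (x i) (y i)) := by
  obtain ⟨w, hwK, hwL⟩ := hKL
  have h : ∀ i, ∃ t, t ∈ Icc (K.lower i) (K.upper i) ∧ t ∈ Icc (L.lower i) (L.upper i) ∧
      t ∈ Icc (min (x i) (y i)) (max (x i) (y i)) := by
    intro i
    have h1 := hwK i; have h2 := hwL i; have h3 := hx i; have h4 := hy i
    simp only [mem_Icc] at *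
    rcases le_total (x i) (y i) with h | h
    · rw [min_eq_left h, max_eq_right h]
      rcases le_total (x i) (L.lower i) with h' | h'
      · exact ⟨L.lower i, ⟨by linarith, by linarith⟩, ⟨le_rfl, by linarith⟩, h', by linarith⟩
      · exact ⟨x i, h3, ⟨h', by linarith⟩, le_rfl, h⟩
    · rw [min_eq_right h, max_eq_left h]
      rcases le_total (x i) (L.upper i) with h' | h'
      · exact ⟨x i, h3, ⟨by linarith, h'⟩, h, le_rfl⟩
      · exact ⟨L.upper i, ⟨by linarith, by linarith⟩, ⟨by linarith, le_rfl⟩, by linarith, h'⟩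
  choose t ht1 ht2 ht3 using h
  exact ⟨WithLp.toLp 2 t, ⟨ht1, ht2⟩, ht3⟩

/-- Non-touching cells of a fixed mesh have a positive distance. -/
theorem RectMesh.exists_separation (T : RectMesh Ω) :
    ∃ δ > 0, ∀ K ∈ T.cells, ∀ L ∈ T.cells, ∀ x ∈ K.closed, ∀ y ∈ L.closed,
      dist x y < δ → (K.closed ∩ L.closed).Nonempty := by
  -- Stated for all sufficiently small `δ`, the claim passes through the finitely many pairs of
  -- cells; disjoint compact cells have positive distance.
  have h : ∀ᶠ δ in nhdsWithin (0 : ℝ) (Ioi 0), ∀ K ∈ T.cells, ∀ L ∈ T.cells, ∀ x ∈ K.closed,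
      ∀ y ∈ L.closed, dist x y < δ → (K.closed ∩ L.closed).Nonempty := by
    rw [Filter.eventually_all_finset]
    intro K hK
    rw [Filter.eventually_all_finset]
    intro L hL
    by_cases hKL : (K.closed ∩ L.closed).Nonempty
    · exact Filter.Eventually.of_forall fun _ _ _ _ _ _ => hKL
    · obtain ⟨r, hr, hr'⟩ := Metric.exists_pos_forall_lt_edist K.isCompact_closed L.isClosed_closed
        (disjoint_iff_inter_eq_empty.2 (not_nonempty_iff_eq_empty.1 hKL))
      filter_upwards [Ioo_mem_nhdsGT (show (0 : ℝ) < r from hr)] with δ hδ x hx y hy hxy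
      have h1 := hr' x hx y hy
      rw [edist_nndist, ENNReal.coe_lt_coe, ← NNReal.coe_lt_coe, coe_nndist] at h1
      linarith [hδ.2]
  obtain ⟨δ, h1, h2⟩ := (h.and self_mem_nhdsWithin).exists
  exact ⟨δ, h2, h1⟩

/-- The reference mesh `T₀` provides a path in `closure Ω`, the given mesh `T` covers it. Nearby
points lie in touching cells of `T₀`, and a common point of these cells inside the box of `x` and
`y` joins them by two segments. The box has sides below `h`, so the corner count applies to `T`. -/
theorem RectMesh.mem_iterate_grow_of_dist_lt (T₀ T : RectMesh Ω) {δ : ℝ}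
    (hδ : ∀ K ∈ T₀.cells, ∀ L ∈ T₀.cells, ∀ x ∈ K.closed, ∀ y ∈ L.closed,
      dist x y < δ → (K.closed ∩ L.closed).Nonempty)
    {h : ℝ} (hT : ∀ K ∈ T.cells, ∀ i, h ≤ K.upper i - K.lower i)
    {S : Finset (Rect d)} (hS : S ⊆ T.cells) {x y : EuclideanSpace ℝ (Fin d)}
    (hx : x ∈ cellUnion S) (hy : y ∈ closure Ω) (hxy : dist x y < δ) (hxy' : dist x y < h) :
    y ∈ cellUnion (T.grow^[2 * 2 ^ d + 1] S) := by
  have hxΩ : x ∈ closure Ω := by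
    rw [T.closure_eq]
    obtain ⟨K, hK, hxK⟩ := mem_cellUnion.1 hx
    exact mem_cellUnion.2 ⟨K, hS hK, hxK⟩
  have hx' := hxΩ
  have hy' := hy
  rw [T₀.closure_eq] at hx' hy'
  obtain ⟨K, hK, hxK⟩ := mem_cellUnion.1 hx'
  obtain ⟨L, hL, hyL⟩ := mem_cellUnion.1 hy'
  obtain ⟨z, hz, hzb⟩ := Rect.exists_mem_inter_between (hδ K hK L hL x hxK y hyL hxy) hxK hyL
  have hsub : ∀ M ∈ T₀.cells, M.closed ⊆ closure Ω := fun M hM => by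
    rw [T₀.closure_eq]
    exact subset_biUnion_of_mem (u := fun M : Rect d => M.closed) hM
  have hconv : Convex ℝ {w : EuclideanSpace ℝ (Fin d) |
      ∀ i, w i ∈ Icc (min (x i) (y i)) (max (x i) (y i))} := by
    intro u hu v hv a b ha hb hab i
    have := convex_Icc _ _ (hu i) (hv i) ha hb hab
    simpa using this
  have hxm : x ∈ {w : EuclideanSpace ℝ (Fin d) |
      ∀ i, w i ∈ Icc (min (x i) (y i)) (max (x i) (y i))} :=
    fun i => ⟨min_le_left _ _, le_max_left _ _⟩
  have hym : y ∈ {w : EuclideanSpace ℝ (Fin d) |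
      ∀ i, w i ∈ Icc (min (x i) (y i)) (max (x i) (y i))} :=
    fun i => ⟨min_le_right _ _, le_max_right _ _⟩
  refine T.subset_iterate_grow_of_isPreconnected (s := segment ℝ x z ∪ segment ℝ z y)
    (a := fun i => min (x i) (y i)) (b := fun i => max (x i) (y i))
    ?_ ?_ hT ?_ ?_ hS ⟨x, Or.inl (left_mem_segment _ _ _), hx⟩ (Or.inr (right_mem_segment _ _ _))
  · exact IsPreconnected.union z (right_mem_segment _ _ _) (left_mem_segment _ _ _)
      (convex_segment _ _).isPreconnected (convex_segment _ _).isPreconnected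
  · exact union_subset ((K.convex_closed.segment_subset hxK hz.1).trans (hsub K hK))
      ((L.convex_closed.segment_subset hz.2 hyL).trans (hsub L hL))
  · intro i
    rw [max_sub_min_eq_abs]
    refine lt_of_le_of_lt ?_ hxy'
    rw [dist_eq_norm, ← norm_neg, neg_sub]
    exact PiLp.norm_apply_le (y - x) i
  · exact union_subset (hconv.segment_subset hxm hzb) (hconv.segment_subset hzb hym)

/-! ### The Poincaré inequality on convex sets -/

theorem norm_gradient (φ : EuclideanSpace ℝ (Fin d) → ℝ) (x : EuclideanSpace ℝ (Fin d)) :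
    ‖∇ φ x‖ = ‖fderiv ℝ φ x‖ := by
  simp [gradient]

theorem continuous_gradient {φ : EuclideanSpace ℝ (Fin d) → ℝ} (hφ : ContDiff ℝ ∞ φ) :
    Continuous (∇ φ) :=
  (LinearIsometryEquiv.continuous _).comp (hφ.continuous_fderiv (by simp))

theorem sq_integral_le_integral_sq {g : ℝ → ℝ} (hg : Continuous g) :
    (∫ t in (0 : ℝ)..1, g t) ^ 2 ≤ ∫ t in (0 : ℝ)..1, g t ^ 2 := by
  set c := ∫ t in (0 : ℝ)..1, g t with hc
  have h1 : 0 ≤ ∫ t in (0 : ℝ)..1, (g t - c) ^ 2 :=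
    intervalIntegral.integral_nonneg zero_le_one fun t _ => sq_nonneg _
  -- The unit interval has length one, so the variance of `g` is its mean square minus the square of
  -- its mean.
  have h2 : ∫ t in (0 : ℝ)..1, (g t - c) ^ 2 = (∫ t in (0 : ℝ)..1, g t ^ 2) - c ^ 2 := by
    have h3 : ∀ t, (g t - c) ^ 2 = g t ^ 2 - (2 * c) * g t + c ^ 2 := fun t => by ring
    simp_rw [h3]
    rw [intervalIntegral.integral_add, intervalIntegral.integral_sub,
      intervalIntegral.integral_const_mul, ← hc]
    · simp; ring
    all_goals exact Continuous.intervalIntegrable (by fun_prop) _ _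
  linarith

theorem sq_sub_le_integral_gradient {φ : EuclideanSpace ℝ (Fin d) → ℝ} (hφ : ContDiff ℝ ∞ φ)
    (x y : EuclideanSpace ℝ (Fin d)) :
    (φ x - φ y) ^ 2 ≤ ‖x - y‖ ^ 2 * ∫ t in (0 : ℝ)..1, ‖∇ φ (y + t • (x - y))‖ ^ 2 := by
  have hd : ∀ z, HasFDerivAt φ (fderiv ℝ φ z) z :=
    fun z => (hφ.differentiable (by simp) z).hasFDerivAt
  have hc : Continuous fun t : ℝ => fderiv ℝ φ (y + t • (x - y)) :=
    (hφ.continuous_fderiv (by simp)).comp (by fun_prop)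
  have hg : Continuous fun t : ℝ => fderiv ℝ φ (y + t • (x - y)) (x - y) :=
    hc.clm_apply continuous_const
  have h1 : ∫ t in (0 : ℝ)..1, fderiv ℝ φ (y + t • (x - y)) (x - y) = φ x - φ y := by
    have h2 : ∀ t ∈ uIcc (0 : ℝ) 1, HasDerivAt (fun t : ℝ => φ (y + t • (x - y)))
        (fderiv ℝ φ (y + t • (x - y)) (x - y)) t := by
      intro t _
      have h3 : HasDerivAt (fun t : ℝ => y + t • (x - y)) (x - y) t := by
        simpa using ((hasDerivAt_id t).smul_const (x - y)).const_add y
      exact (hd _).comp_hasDerivAt t h3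
    rw [intervalIntegral.integral_eq_sub_of_hasDerivAt h2 (hg.intervalIntegrable _ _)]
    simp
  rw [← h1]
  refine (sq_integral_le_integral_sq hg).trans ?_
  rw [← intervalIntegral.integral_const_mul]
  apply intervalIntegral.integral_mono_on zero_le_one
  · exact (hg.pow 2).intervalIntegrable _ _
  · exact (continuous_const.mul
      (((continuous_gradient hφ).comp (by fun_prop)).norm.pow 2)).intervalIntegrable _ _
  · intro t _
    rw [norm_gradient, ← mul_pow, ← sq_abs]
    gcongr
    rw [mul_comm]
    exact ContinuousLinearMap.le_opNorm (fderiv ℝ φ (y + t • (x - y))) (x - y)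

theorem lintegral_comp_add_smul {F : EuclideanSpace ℝ (Fin d) → ENNReal} (hF : Measurable F)
    (c : EuclideanSpace ℝ (Fin d)) {t : ℝ} (ht : 1 / 2 ≤ t) :
    ∫⁻ x, F (c + t • x) ≤ 2 ^ d * ∫⁻ x, F x := by
  have ht0 : 0 < t := by linarith
  have h1 : ∫⁻ x, F (c + t • x) = ∫⁻ x, F (c + x) ∂(Measure.map (fun x => t • x) volume) := by
    rw [lintegral_map (by fun_prop) (by fun_prop)]
  rw [h1, Measure.map_addHaar_smul _ ht0.ne', lintegral_smul_measure,
    lintegral_add_left_eq_self, smul_eq_mul]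
  gcongr
  have h3 : (2 : ENNReal) ^ d = ENNReal.ofReal (2 ^ d) := by
    rw [ENNReal.ofReal_pow (by norm_num)]; simp
  rw [h3]
  apply ENNReal.ofReal_le_ofReal
  rw [finrank_euclideanSpace, Fintype.card_fin, abs_of_pos (by positivity), ← inv_pow]
  have h4 : t⁻¹ ≤ 2 := by
    rw [inv_le_comm₀ ht0 (by norm_num)]
    linarith
  gcongr

/-- One of `t` and `1 - t` is at least `1 / 2`. Integrating first in the variable carrying that
factor costs a Jacobian of at most `2 ^ d`, uniformly in `t`. -/
theorem lintegral_lintegral_segment_le {F : EuclideanSpace ℝ (Fin d) → ENNReal}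
    (hF : Measurable F) (K : Set (EuclideanSpace ℝ (Fin d))) (t : ℝ) :
    ∫⁻ x in K, ∫⁻ y in K, F (y + t • (x - y)) ≤ 2 ^ d * volume K * ∫⁻ z, F z := by
  have hm : Measurable fun q : EuclideanSpace ℝ (Fin d) × EuclideanSpace ℝ (Fin d) =>
      F (q.2 + t • (q.1 - q.2)) := hF.comp (by fun_prop)
  rcases le_total (1 / 2) t with ht | ht
  · rw [lintegral_lintegral_swap hm.aemeasurable]
    have h1 : ∀ y, ∫⁻ x in K, F (y + t • (x - y)) ≤ 2 ^ d * ∫⁻ z, F z := by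
      intro y
      refine (setLIntegral_le_lintegral _ _).trans ?_
      have h2 : ∀ x, y + t • (x - y) = (y - t • y) + t • x := fun x => by
        rw [smul_sub]; abel
      simp_rw [h2]
      exact lintegral_comp_add_smul hF _ ht
    refine (lintegral_mono h1).trans ?_
    rw [lintegral_const, Measure.restrict_apply_univ]
    exact le_of_eq (by ring)
  · have h1 : ∀ x, ∫⁻ y in K, F (y + t • (x - y)) ≤ 2 ^ d * ∫⁻ z, F z := by
      intro x
      refine (setLIntegral_le_lintegral _ _).trans ?_
      have h2 : ∀ y, y + t • (x - y) = t • x + (1 - t) • y := fun y => by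
        rw [smul_sub, sub_smul, one_smul]; abel
      simp_rw [h2]
      exact lintegral_comp_add_smul hF _ (by linarith)
    refine (lintegral_mono h1).trans ?_
    rw [lintegral_const, Measure.restrict_apply_univ]
    exact le_of_eq (by ring)

/-- Integrate the fundamental theorem of calculus along all segments between points of `K`.
Convexity keeps the segments in `K`, so `∇ φ` may be cut off to zero outside; Tonelli moves the
segment parameter outermost, where the previous lemma applies. -/
theorem lintegral_lintegral_sq_sub_le {φ : EuclideanSpace ℝ (Fin d) → ℝ} (hφ : ContDiff ℝ ∞ φ)
    {K : Set (EuclideanSpace ℝ (Fin d))} (hKm : MeasurableSet K) (hKc : Convex ℝ K)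
    {D : ℝ} (hKD : ∀ x ∈ K, ∀ y ∈ K, dist x y ≤ D) :
    ∫⁻ x in K, ∫⁻ y in K, ENNReal.ofReal ((φ x - φ y) ^ 2) ≤
      ENNReal.ofReal (D ^ 2) * (2 ^ d * volume K * ∫⁻ z in K, ENNReal.ofReal (‖∇ φ z‖ ^ 2)) := by
  set F : EuclideanSpace ℝ (Fin d) → ENNReal :=
    K.indicator fun z => ENNReal.ofReal (‖∇ φ z‖ ^ 2) with hFdef
  have hcg : Continuous fun z => ‖∇ φ z‖ ^ 2 := (continuous_gradient hφ).norm.pow 2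
  have hF : Measurable F := (ENNReal.measurable_ofReal.comp hcg.measurable).indicator hKm
  have h1 : ∀ x ∈ K, ∀ y ∈ K, ENNReal.ofReal ((φ x - φ y) ^ 2) ≤
      ENNReal.ofReal (D ^ 2) * ∫⁻ t in Ioc (0 : ℝ) 1, F (y + t • (x - y)) := by
    intro x hx y hy
    have h2 : ∫⁻ t in Ioc (0 : ℝ) 1, F (y + t • (x - y)) =
        ENNReal.ofReal (∫ t in (0 : ℝ)..1, ‖∇ φ (y + t • (x - y))‖ ^ 2) := by
      have hc : Continuous fun t : ℝ => ‖∇ φ (y + t • (x - y))‖ ^ 2 := hcg.comp (by fun_prop)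
      rw [intervalIntegral.integral_of_le zero_le_one, ofReal_integral_eq_lintegral_ofReal
        (hc.integrableOn_Ioc) (Filter.Eventually.of_forall fun t => by positivity)]
      apply setLIntegral_congr_fun measurableSet_Ioc
      intro t ht
      have : y + t • (x - y) ∈ K := hKc.add_smul_sub_mem hy hx (Ioc_subset_Icc_self ht)
      simp [hFdef, this]
    rw [h2, ← ENNReal.ofReal_mul (by positivity)]
    apply ENNReal.ofReal_le_ofReal
    refine (sq_sub_le_integral_gradient hφ x y).trans ?_
    have h3 : 0 ≤ ∫ t in (0 : ℝ)..1, ‖∇ φ (y + t • (x - y))‖ ^ 2 :=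
      intervalIntegral.integral_nonneg zero_le_one fun t _ => by positivity
    gcongr
    rw [← dist_eq_norm]
    exact hKD x hx y hy
  have hm3 : Measurable fun q : (EuclideanSpace ℝ (Fin d) × EuclideanSpace ℝ (Fin d)) × ℝ =>
      F (q.1.2 + q.2 • (q.1.1 - q.1.2)) := hF.comp (by fun_prop)
  calc ∫⁻ x in K, ∫⁻ y in K, ENNReal.ofReal ((φ x - φ y) ^ 2)
      ≤ ∫⁻ x in K, ∫⁻ y in K, ENNReal.ofReal (D ^ 2) *
          ∫⁻ t in Ioc (0 : ℝ) 1, F (y + t • (x - y)) :=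
        setLIntegral_mono' hKm fun x hx => setLIntegral_mono' hKm fun y hy => h1 x hx y hy
    _ = ENNReal.ofReal (D ^ 2) *
          ∫⁻ x in K, ∫⁻ y in K, ∫⁻ t in Ioc (0 : ℝ) 1, F (y + t • (x - y)) := by
        rw [← lintegral_const_mul' _ _ ENNReal.ofReal_ne_top]
        refine lintegral_congr fun x => ?_
        rw [← lintegral_const_mul' _ _ ENNReal.ofReal_ne_top]
    _ = ENNReal.ofReal (D ^ 2) *
          ∫⁻ x in K, ∫⁻ t in Ioc (0 : ℝ) 1, ∫⁻ y in K, F (y + t • (x - y)) := by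
        congr 1
        refine lintegral_congr fun x => ?_
        exact lintegral_lintegral_swap
          (f := fun y t => F (y + t • (x - y))) (hF.comp (by fun_prop)).aemeasurable
    _ = ENNReal.ofReal (D ^ 2) *
          ∫⁻ t in Ioc (0 : ℝ) 1, ∫⁻ x in K, ∫⁻ y in K, F (y + t • (x - y)) := by
        congr 1
        refine lintegral_lintegral_swap
          (f := fun x t => ∫⁻ y in K, F (y + t • (x - y))) (Measurable.aemeasurable ?_)
        exact Measurable.lintegral_prod_right'
          (f := fun q : (EuclideanSpace ℝ (Fin d) × ℝ) × EuclideanSpace ℝ (Fin d) =>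
            F (q.2 + q.1.2 • (q.1.1 - q.2))) (hF.comp (by fun_prop))
    _ ≤ ENNReal.ofReal (D ^ 2) * ∫⁻ _ in Ioc (0 : ℝ) 1, 2 ^ d * volume K * ∫⁻ z, F z := by
        gcongr with t
        exact lintegral_lintegral_segment_le hF K t
    _ = _ := by
        rw [lintegral_const, Measure.restrict_apply_univ, Real.volume_Ioc, hFdef,
          lintegral_indicator hKm]
        simp

/-- Expanding the square turns the double integral of `(φ x - φ y) ^ 2` into twice the left-hand
side. Keeping the mean term makes every term continuous in the `H¹` norm, so the bound survives
passage to `H¹₀`. -/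
theorem poincare_of_contDiff {φ : EuclideanSpace ℝ (Fin d) → ℝ} (hφ : ContDiff ℝ ∞ φ)
    {K : Set (EuclideanSpace ℝ (Fin d))} (hKm : MeasurableSet K) (hKc : Convex ℝ K)
    {D : ℝ} (hKD : ∀ x ∈ K, ∀ y ∈ K, dist x y ≤ D) (hKb : Bornology.IsBounded K) :
    volume.real K * (∫ x in K, φ x ^ 2) - (∫ x in K, φ x) ^ 2 ≤
      2 ^ d * D ^ 2 * volume.real K * ∫ x in K, ‖∇ φ x‖ ^ 2 := by
  have hint : ∀ f : EuclideanSpace ℝ (Fin d) → ℝ, Continuous f → IntegrableOn f K volume :=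
    fun f hf => (hf.continuousOn.integrableOn_compact
      (hKb.isCompact_closure)).mono_set subset_closure
  have hφc := hφ.continuous
  have hcg : Continuous fun z => ‖∇ φ z‖ ^ 2 := (continuous_gradient hφ).norm.pow 2
  have hfin : IsFiniteMeasure (volume.restrict K) :=
    ⟨by rw [Measure.restrict_apply_univ]; exact hKb.measure_lt_top⟩
  set s := ∫ x in K, φ x ^ 2 with hs
  set m := ∫ x in K, φ x with hm
  have h1 : ∀ x, ∫⁻ y in K, ENNReal.ofReal ((φ x - φ y) ^ 2) =
      ENNReal.ofReal (volume.real K * φ x ^ 2 - (2 * m) * φ x + s) := by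
    intro x
    rw [← ofReal_integral_eq_lintegral_ofReal (hint _ (by fun_prop))
      (Filter.Eventually.of_forall fun y => by positivity)]
    congr 1
    have h2 : ∀ y, (φ x - φ y) ^ 2 = φ x ^ 2 - (2 * φ x) * φ y + φ y ^ 2 := fun y => by ring
    simp_rw [h2]
    rw [integral_add, integral_sub, integral_const_mul, ← hs, ← hm]
    · simp; ring
    all_goals exact hint _ (by fun_prop)
  have h3 : ∫⁻ x in K, ∫⁻ y in K, ENNReal.ofReal ((φ x - φ y) ^ 2) =
      ENNReal.ofReal (2 * (volume.real K * s - m ^ 2)) := by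
    simp_rw [h1]
    rw [← ofReal_integral_eq_lintegral_ofReal (hint _ (by fun_prop))]
    · rw [integral_add, integral_sub, integral_const_mul, integral_const_mul, ← hs, ← hm]
      · congr 1; simp; ring
      all_goals exact hint _ (by fun_prop)
    · refine Filter.Eventually.of_forall fun x => ?_
      have h4 : volume.real K * φ x ^ 2 - (2 * m) * φ x + s = ∫ y in K, (φ x - φ y) ^ 2 := by
        have h2 : ∀ y, (φ x - φ y) ^ 2 = φ x ^ 2 - (2 * φ x) * φ y + φ y ^ 2 := fun y => by ring
        simp_rw [h2]
        rw [integral_add, integral_sub, integral_const_mul, ← hs, ← hm]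
        · simp; ring
        all_goals exact hint _ (by fun_prop)
      simp only [Pi.zero_apply]
      rw [h4]
      exact integral_nonneg fun y => by positivity
  have h5 := lintegral_lintegral_sq_sub_le hφ hKm hKc hKD
  rw [h3, ← ofReal_integral_eq_lintegral_ofReal (hint _ hcg)
    (Filter.Eventually.of_forall fun y => by positivity),
    ← ENNReal.ofReal_toReal hKb.measure_lt_top.ne] at h5
  have h6 : (2 : ENNReal) ^ d = ENNReal.ofReal (2 ^ d) := by
    rw [ENNReal.ofReal_pow (by norm_num)]; simp
  have h7 : 0 ≤ ∫ x in K, ‖∇ φ x‖ ^ 2 := integral_nonneg fun y => by positivity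
  rw [h6, ← ENNReal.ofReal_mul (by positivity), ← ENNReal.ofReal_mul (by positivity),
    ← ENNReal.ofReal_mul (by positivity), ENNReal.ofReal_le_ofReal_iff (by positivity)] at h5
  change _ ≤ D ^ 2 * (2 ^ d * volume.real K * _) at h5
  -- The factor two from the double integral is discarded, which is legitimate because the
  -- right-hand side is nonnegative.
  have h8 : 0 ≤ D ^ 2 * (2 ^ d * volume.real K * ∫ x in K, ‖∇ φ x‖ ^ 2) := by positivity
  nlinarith

/-! ### Integrals over subsets as continuous functions on `L²` -/

theorem restrict_restrict_inner (T : RectMesh Ω) {K : Rect d} (hK : K ∈ T.cells) :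
    (volume.restrict Ω).restrict K.inner = volume.restrict K.inner :=
  Measure.restrict_restrict_of_subset (T.inner_subset K hK)

theorem continuous_setIntegral_norm_sq {F : Type*} [NormedAddCommGroup F] [InnerProductSpace ℝ F]
    {S : Set (EuclideanSpace ℝ (Fin d))} (hS : S ⊆ Ω) :
    Continuous fun f : Lp F 2 (volume.restrict Ω) => ∫ x in S, ‖f x‖ ^ 2 := by
  have h1 : ∀ f : Lp F 2 (volume.restrict Ω), ∫ x in S, ‖f x‖ ^ 2 =
      ‖LpToLpRestrictCLM _ F ℝ (volume.restrict Ω) 2 S f‖ ^ 2 := by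
    intro f
    rw [← real_inner_self_eq_norm_sq, L2.inner_def]
    rw [← Measure.restrict_restrict_of_subset (μ := volume) hS]
    apply integral_congr_ae
    filter_upwards [LpToLpRestrictCLM_coeFn ℝ S f] with x hx
    rw [hx, real_inner_self_eq_norm_sq]
  simp_rw [h1]
  fun_prop

theorem continuous_setIntegral_L2 {S : Set (EuclideanSpace ℝ (Fin d))} (hS : S ⊆ Ω)
    (hSm : MeasurableSet S) (hSf : volume S ≠ ⊤) :
    Continuous fun f : L2 Ω => ∫ x in S, f x := by
  have hSf' : (volume.restrict Ω) S ≠ ⊤ :=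
    ((Measure.restrict_apply_le _ _).trans_lt hSf.lt_top).ne
  have h1 : ∀ f : L2 Ω, ∫ x in S, f x = inner ℝ (indicatorConstLp 2 hSm hSf' (1 : ℝ)) f := by
    intro f
    rw [L2.inner_indicatorConstLp_one, Measure.restrict_restrict_of_subset hS]
  simp_rw [h1]
  fun_prop

/-- Both sides are continuous on `L2Pair Ω`, so the inequality defines a closed set; it contains the
test pairs and therefore their closure. -/
theorem poincare_H10 {z : L2Pair Ω} (hz : z ∈ H10 Ω) {K : Rect d} (hK : K.inner ⊆ Ω) :
    volume.real K.inner * (∫ x in K.inner, z.fst x ^ 2) - (∫ x in K.inner, z.fst x) ^ 2 ≤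
      2 ^ d * Metric.diam K.closed ^ 2 * volume.real K.inner * ∫ x in K.inner, ‖z.snd x‖ ^ 2 := by
  have hcl : IsClosed {z : L2Pair Ω |
      volume.real K.inner * (∫ x in K.inner, ‖z.fst x‖ ^ 2) - (∫ x in K.inner, z.fst x) ^ 2 ≤
      2 ^ d * Metric.diam K.closed ^ 2 * volume.real K.inner *
        ∫ x in K.inner, ‖z.snd x‖ ^ 2} := by
    have c1 : Continuous fun z : L2Pair Ω => ∫ x in K.inner, ‖z.fst x‖ ^ 2 :=
      (continuous_setIntegral_norm_sq hK).comp (continuous_fst.comp (WithLp.prod_continuous_ofLp ..))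
    have c2 : Continuous fun z : L2Pair Ω => ∫ x in K.inner, ‖z.snd x‖ ^ 2 :=
      (continuous_setIntegral_norm_sq hK).comp (continuous_snd.comp (WithLp.prod_continuous_ofLp ..))
    have c3 : Continuous fun z : L2Pair Ω => ∫ x in K.inner, z.fst x :=
      (continuous_setIntegral_L2 hK K.isOpen_inner.measurableSet
        K.volume_inner_lt_top.ne).comp (continuous_fst.comp (WithLp.prod_continuous_ofLp ..))
    exact isClosed_le (by fun_prop) (by fun_prop)
  have hsub : ((testPairs Ω : Submodule ℝ (L2Pair Ω)) : Set (L2Pair Ω)) ⊆ {z : L2Pair Ω |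
      volume.real K.inner * (∫ x in K.inner, ‖z.fst x‖ ^ 2) - (∫ x in K.inner, z.fst x) ^ 2 ≤
      2 ^ d * Metric.diam K.closed ^ 2 * volume.real K.inner *
        ∫ x in K.inner, ‖z.snd x‖ ^ 2} := by
    rintro z ⟨φ, hφ, -, -, h1, h2⟩
    have e1 := ae_mono (Measure.restrict_mono_set volume hK) h1
    have e2 := ae_mono (Measure.restrict_mono_set volume hK) h2
    have i1 : ∫ x in K.inner, ‖z.fst x‖ ^ 2 = ∫ x in K.inner, φ x ^ 2 :=
      integral_congr_ae (by filter_upwards [e1] with x hx; rw [hx]; simp)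
    have i2 : ∫ x in K.inner, z.fst x = ∫ x in K.inner, φ x := integral_congr_ae e1
    have i3 : ∫ x in K.inner, ‖z.snd x‖ ^ 2 = ∫ x in K.inner, ‖∇ φ x‖ ^ 2 :=
      integral_congr_ae (by filter_upwards [e2] with x hx; rw [hx])
    rw [mem_ofPred_eq, i1, i2, i3]
    have hb := K.isCompact_closed.isBounded
    exact poincare_of_contDiff hφ K.isOpen_inner.measurableSet K.convex_inner
      (fun x hx y hy => Metric.dist_le_diam_of_mem hb (K.inner_subset_closed hx)
        (K.inner_subset_closed hy)) (hb.subset K.inner_subset_closed)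
  have h := closure_minimal hsub hcl hz
  simpa using h

/-! ### Test functions -/

/-- The smooth functions with compact support in `U`. -/
def testFunctions (U : Set (EuclideanSpace ℝ (Fin d))) :
    Submodule ℝ (EuclideanSpace ℝ (Fin d) → ℝ) where
  carrier := {φ | ContDiff ℝ ∞ φ ∧ HasCompactSupport φ ∧ tsupport φ ⊆ U}
  zero_mem' := by
    refine ⟨contDiff_const, HasCompactSupport.zero, ?_⟩
    have h : tsupport (0 : EuclideanSpace ℝ (Fin d) → ℝ) = ∅ := by simp [tsupport]
    simp [h]
  add_mem' := by
    rintro φ ψ ⟨h1, h2, h3⟩ ⟨h4, h5, h6⟩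
    exact ⟨h1.add h4, h2.add h5, (tsupport_add φ ψ).trans (union_subset h3 h6)⟩
  smul_mem' := by
    rintro c φ ⟨h1, h2, h3⟩
    exact ⟨h1.const_smul c, h2.smul_left (f := fun _ => c),
      (closure_mono (Function.support_const_smul_subset c φ)).trans h3⟩

theorem integrable_testFunction_mul {U : Set (EuclideanSpace ℝ (Fin d))}
    {φ : EuclideanSpace ℝ (Fin d) → ℝ} (hφ : φ ∈ testFunctions U)
    {g : EuclideanSpace ℝ (Fin d) → ℝ} (hg : Continuous g) :
    Integrable (fun x => φ x * g x) :=
  (hφ.1.continuous.mul hg).integrable_of_hasCompactSupport hφ.2.1.mul_right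

theorem sq_integral_inner_le {X F : Type*} [MeasurableSpace X] {μ : Measure X}
    [NormedAddCommGroup F] [InnerProductSpace ℝ F] {f g : X → F}
    (hf : MemLp f 2 μ) (hg : MemLp g 2 μ) :
    (∫ x, inner ℝ (f x) (g x) ∂μ) ^ 2 ≤ (∫ x, ‖f x‖ ^ 2 ∂μ) * ∫ x, ‖g x‖ ^ 2 ∂μ := by
  have h1 : inner ℝ (hf.toLp f) (hg.toLp g) = ∫ x, inner ℝ (f x) (g x) ∂μ := by
    rw [L2.inner_def]
    apply integral_congr_ae
    filter_upwards [hf.coeFn_toLp, hg.coeFn_toLp] with x h2 h3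
    rw [h2, h3]
  have h2 : ∀ {f : X → F} (hf : MemLp f 2 μ), ‖hf.toLp f‖ ^ 2 = ∫ x, ‖f x‖ ^ 2 ∂μ := by
    intro f hf
    rw [← real_inner_self_eq_norm_sq, L2.inner_def]
    apply integral_congr_ae
    filter_upwards [hf.coeFn_toLp] with x h2
    rw [h2, real_inner_self_eq_norm_sq]
  rw [← h1, ← h2 hf, ← h2 hg, ← mul_pow, ← sq_abs]
  gcongr
  exact abs_real_inner_le_norm _ _

theorem sq_integral_mul_le {X : Type*} [MeasurableSpace X] {μ : Measure X} {f g : X → ℝ}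
    (hf : MemLp f 2 μ) (hg : MemLp g 2 μ) :
    (∫ x, f x * g x ∂μ) ^ 2 ≤ (∫ x, f x ^ 2 ∂μ) * ∫ x, g x ^ 2 ∂μ := by
  have h := sq_integral_inner_le hg hf
  simp only [Real.norm_eq_abs, sq_abs] at h
  rw [mul_comm (∫ x, f x ^ 2 ∂μ)]
  exact h

/-! ### Functions dual to the monomials -/

/-- The open unit cube, as a rectangle. -/
def unitRect (d : ℕ) : Rect d := ⟨fun _ => 0, fun _ => 1, fun _ => zero_lt_one⟩

/-- The monomial with exponents `I`. -/
def mono {p : ℕ} (I : Fin d → Fin (p + 1)) (x : EuclideanSpace ℝ (Fin d)) : ℝ :=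
  ∏ i, x i ^ (I i : ℕ)

theorem continuous_mono {p : ℕ} (I : Fin d → Fin (p + 1)) : Continuous (mono I) := by
  unfold mono; fun_prop

/-- A polynomial vanishing on a product of infinite sets is zero. -/
theorem coeff_eq_zero_of_sum_mono_eq_zero {p : ℕ} {c : (Fin d → Fin (p + 1)) → ℝ}
    (h : ∀ x ∈ (unitRect d).inner, ∑ I, c I * mono I x = 0) : c = 0 := by
  let e : (Fin d → Fin (p + 1)) → (Fin d →₀ ℕ) := fun I =>
    Finsupp.equivFunOnFinite.symm fun i => (I i : ℕ)
  have he : Function.Injective e := by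
    intro I J hIJ
    have h1 := Finsupp.equivFunOnFinite.symm.injective hIJ
    funext i
    exact Fin.ext (congrFun h1 i)
  let q : MvPolynomial (Fin d) ℝ := ∑ I, MvPolynomial.monomial (e I) (c I)
  have hq : q = 0 := by
    apply MvPolynomial.funext_set (fun _ => Ioo (0 : ℝ) 1) fun _ => Ioo_infinite zero_lt_one
    intro x hx
    have h1 := h (WithLp.toLp 2 x) fun i => hx i (mem_univ i)
    rw [map_zero, ← h1, map_sum]
    refine Finset.sum_congr rfl fun I _ => ?_
    rw [MvPolynomial.eval_monomial, Finsupp.prod_fintype _ _ (by simp)]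
    rfl
  funext I
  have h2 : MvPolynomial.coeff (e I) q = c I := by
    classical
    simp only [q, MvPolynomial.coeff_sum, MvPolynomial.coeff_monomial]
    rw [Finset.sum_eq_single I]
    · simp
    · intro J _ hJ
      rw [if_neg (he.ne hJ)]
    · simp
  rw [← h2, hq]
  simp

/-- The moment map from test functions to a finite-dimensional space is onto. Otherwise a nonzero
functional kills its range; its coefficients form a polynomial orthogonal to all test functions on
the cube, which must vanish. -/
theorem exists_dual_testFunctions (d p : ℕ) :
    ∃ b : (Fin d → Fin (p + 1)) → EuclideanSpace ℝ (Fin d) → ℝ,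
      (∀ J, b J ∈ testFunctions (unitRect d).inner) ∧
      ∀ I J, ∫ x, b J x * mono I x = if I = J then 1 else 0 := by
  classical
  let Λ : testFunctions (unitRect d).inner →ₗ[ℝ] ((Fin d → Fin (p + 1)) → ℝ) :=
    { toFun := fun φ I => ∫ x, φ.1 x * mono I x
      map_add' := fun φ ψ => by
        funext I
        simp only [Submodule.coe_add, Pi.add_apply, add_mul]
        exact integral_add (integrable_testFunction_mul φ.2 (continuous_mono I))
          (integrable_testFunction_mul ψ.2 (continuous_mono I))
      map_smul' := fun c φ => by
        funext I
        simp only [Submodule.coe_smul, Pi.smul_apply, smul_eq_mul, mul_assoc, RingHom.id_apply]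
        exact integral_const_mul _ _ }
  have hΛ : LinearMap.range Λ = ⊤ := by
    by_contra hne
    obtain ⟨f, hf0, hf⟩ := Submodule.exists_le_ker_of_lt_top _ (lt_top_iff_ne_top.2 hne)
    set c : (Fin d → Fin (p + 1)) → ℝ := fun I => f (Pi.single I 1) with hc
    have hfc : ∀ v, f v = ∑ I, c I * v I := by
      intro v
      conv_lhs => rw [pi_eq_sum_univ' v]
      rw [map_sum]
      refine Finset.sum_congr rfl fun I _ => ?_
      rw [map_smul, smul_eq_mul, mul_comm]
    have hcont : Continuous fun x : EuclideanSpace ℝ (Fin d) => ∑ I, c I * mono I x :=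
      continuous_finsetSum _ fun I _ => continuous_const.mul (continuous_mono I)
    have h1 : ∀ᵐ x ∂(volume : Measure (EuclideanSpace ℝ (Fin d))),
        x ∈ (unitRect d).inner → ∑ I, c I * mono I x = 0 := by
      apply (unitRect d).isOpen_inner.ae_eq_zero_of_integral_contDiff_smul_eq_zero
        (hcont.locallyIntegrable.locallyIntegrableOn _)
      intro g hg1 hg2 hg3
      have h2 : f (Λ ⟨g, hg1, hg2, hg3⟩) = 0 := hf ⟨_, rfl⟩
      rw [hfc] at h2
      rw [← h2]
      simp only [smul_eq_mul, Finset.mul_sum]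
      rw [integral_finsetSum]
      · refine Finset.sum_congr rfl fun I _ => ?_
        simp only [mul_left_comm (g _)]
        exact integral_const_mul _ _
      · intro I _
        exact integrable_testFunction_mul (U := (unitRect d).inner) ⟨hg1, hg2, hg3⟩
          (continuous_const.mul (continuous_mono I))
    have h2 : EqOn (fun x => ∑ I, c I * mono I x) (fun _ => 0) (unitRect d).inner :=
      Measure.eqOn_open_of_ae_eq
        ((ae_restrict_iff' (unitRect d).isOpen_inner.measurableSet).2 h1)
        (unitRect d).isOpen_inner hcont.continuousOn continuousOn_const
    have h3 := coeff_eq_zero_of_sum_mono_eq_zero h2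
    apply hf0
    ext v
    simp [hfc, h3]
  choose b hb using fun J => LinearMap.range_eq_top.1 hΛ (Pi.single J 1)
  refine ⟨fun J => (b J).1, fun J => (b J).2, fun I J => ?_⟩
  have := congrFun (hb J) I
  rw [Pi.single_apply] at this
  exact this

/-! ### The affine map of a rectangle onto the unit cube -/

/-- The linear part of the affine map of `K` onto the unit cube. -/
noncomputable def Rect.scale (K : Rect d) :
    EuclideanSpace ℝ (Fin d) ≃ₗ[ℝ] EuclideanSpace ℝ (Fin d) where
  toFun x := WithLp.toLp 2 fun i => x i / (K.upper i - K.lower i)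
  invFun x := WithLp.toLp 2 fun i => x i * (K.upper i - K.lower i)
  map_add' x y := by ext i; simp [add_div]
  map_smul' c x := by ext i; simp [mul_div_assoc]
  left_inv x := by
    ext i; simp [div_mul_cancel₀ _ (sub_pos.2 (K.lower_lt_upper i)).ne']
  right_inv x := by
    ext i; simp [mul_div_cancel_right₀ _ (sub_pos.2 (K.lower_lt_upper i)).ne']

/-- The affine map of `K` onto the unit cube. -/
noncomputable def Rect.toUnit (K : Rect d) :
    EuclideanSpace ℝ (Fin d) ≃ₜ EuclideanSpace ℝ (Fin d) :=
  (Homeomorph.addRight (-WithLp.toLp 2 K.lower)).trans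
    K.scale.toContinuousLinearEquiv.toHomeomorph

theorem Rect.toUnit_eq (K : Rect d) (x : EuclideanSpace ℝ (Fin d)) :
    K.toUnit x = K.scale (x + -WithLp.toLp 2 K.lower) := rfl

theorem Rect.toUnit_apply (K : Rect d) (x : EuclideanSpace ℝ (Fin d)) (i : Fin d) :
    K.toUnit x i = (x i - K.lower i) / (K.upper i - K.lower i) := by
  rw [K.toUnit_eq]
  simp [Rect.scale, sub_eq_add_neg]

theorem Rect.toUnit_mem_inner (K : Rect d) {x : EuclideanSpace ℝ (Fin d)} :
    K.toUnit x ∈ (unitRect d).inner ↔ x ∈ K.inner := by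
  refine forall_congr' fun i => ?_
  have h := sub_pos.2 (K.lower_lt_upper i)
  rw [K.toUnit_apply, mem_Ioo, mem_Ioo]
  simp only [unitRect]
  rw [div_pos_iff_of_pos_right h, div_lt_one h]
  constructor <;> rintro ⟨h1, h2⟩ <;> constructor <;> linarith

theorem Rect.norm_scale_le (K : Rect d) {h : ℝ} (hh : 0 < h)
    (hK : ∀ i, h ≤ K.upper i - K.lower i) (x : EuclideanSpace ℝ (Fin d)) :
    ‖K.scale x‖ ≤ h⁻¹ * ‖x‖ := by
  have h1 : h⁻¹ * ‖x‖ = ‖h⁻¹ • x‖ := by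
    rw [norm_smul, Real.norm_of_nonneg (by positivity)]
  rw [h1, EuclideanSpace.norm_eq, EuclideanSpace.norm_eq]
  gcongr with i
  simp only [Rect.scale, LinearEquiv.coe_mk, LinearMap.coe_mk, AddHom.coe_mk, PiLp.smul_apply,
    smul_eq_mul, norm_mul, div_eq_inv_mul, norm_inv]
  rw [Real.norm_of_nonneg (hh.le.trans (hK i)), Real.norm_of_nonneg hh.le]
  gcongr
  exact hK i

theorem Rect.contDiff_toUnit (K : Rect d) : ContDiff ℝ ∞ K.toUnit :=
  (K.scale.toContinuousLinearEquiv.contDiff).comp (contDiff_id.add contDiff_const)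

theorem Rect.norm_fderiv_comp_toUnit_le (K : Rect d) {h : ℝ} (hh : 0 < h)
    (hK : ∀ i, h ≤ K.upper i - K.lower i) {φ : EuclideanSpace ℝ (Fin d) → ℝ}
    (hφ : ContDiff ℝ ∞ φ) {M : ℝ} (hM : ∀ x, ‖fderiv ℝ φ x‖ ≤ M) (x : EuclideanSpace ℝ (Fin d)) :
    ‖fderiv ℝ (fun y => φ (K.toUnit y)) x‖ ≤ M * h⁻¹ := by
  have h1 : HasFDerivAt K.toUnit
      (K.scale.toContinuousLinearEquiv : EuclideanSpace ℝ (Fin d) →L[ℝ] _) x := by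
    have h := (K.scale.toContinuousLinearEquiv.hasFDerivAt
      (x := x + -WithLp.toLp 2 K.lower)).comp x ((hasFDerivAt_id x).add_const _)
    rw [ContinuousLinearMap.comp_id] at h
    exact h
  have h2 := ((hφ.differentiable (by simp) (K.toUnit x)).hasFDerivAt).comp x h1
  have h3 : fderiv ℝ (fun y => φ (K.toUnit y)) x = _ := h2.fderiv
  rw [h3]
  refine (ContinuousLinearMap.opNorm_comp_le _ _).trans ?_
  have hM0 : 0 ≤ M := (norm_nonneg _).trans (hM x)
  gcongr
  · exact hM _
  · exact ContinuousLinearMap.opNorm_le_bound _ (by positivity) (K.norm_scale_le hh hK)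

/-- The constant is the Jacobian of the affine change of variables. Its value is never needed, only
that the same `c` scales volumes and integrals. -/
theorem Rect.exists_integral_comp_toUnit (K : Rect d) : ∃ c : ℝ, 0 < c ∧
    volume.real K.inner = c * volume.real (unitRect d).inner ∧
    ∀ f : EuclideanSpace ℝ (Fin d) → ℝ, ∫ x, f (K.toUnit x) = c * ∫ x, f x := by
  have hdet : LinearMap.det (K.scale : EuclideanSpace ℝ (Fin d) →ₗ[ℝ] _) ≠ 0 :=
    K.scale.isUnit_det'.ne_zero
  have key : ∀ f : EuclideanSpace ℝ (Fin d) → ℝ, ∫ x, f (K.toUnit x) =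
      |(LinearMap.det (K.scale : EuclideanSpace ℝ (Fin d) →ₗ[ℝ] _))⁻¹| * ∫ x, f x := by
    intro f
    simp_rw [K.toUnit_eq]
    rw [integral_add_right_eq_self (fun x => f (K.scale x))]
    have h1 := K.scale.toContinuousLinearEquiv.toHomeomorph.measurableEmbedding.integral_map
      (μ := volume) f
    have h2 := Measure.map_linearMap_addHaar_eq_smul_addHaar
      (volume : Measure (EuclideanSpace ℝ (Fin d))) hdet
    change ∫ y, f y ∂(Measure.map K.scale volume) = ∫ x, f (K.scale x) at h1
    change Measure.map K.scale volume = _ at h2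
    rw [← h1, h2, integral_smul_measure, ENNReal.toReal_ofReal (abs_nonneg _), smul_eq_mul]
  refine ⟨_, abs_pos.2 (inv_ne_zero hdet), ?_, key⟩
  have h1 := key ((unitRect d).inner.indicator 1)
  rw [integral_indicator_one (unitRect d).isOpen_inner.measurableSet] at h1
  rw [← h1, ← integral_indicator_one K.isOpen_inner.measurableSet]
  congr 1
  funext x
  by_cases hx : x ∈ K.inner
  · rw [indicator_of_mem hx, indicator_of_mem (K.toUnit_mem_inner.2 hx)]
    rfl
  · rw [indicator_of_notMem hx, indicator_of_notMem (mt K.toUnit_mem_inner.1 hx)]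

theorem abs_mono_le_one {p : ℕ} (I : Fin d → Fin (p + 1)) {x : EuclideanSpace ℝ (Fin d)}
    (hx : x ∈ (unitRect d).inner) : |mono I x| ≤ 1 := by
  unfold mono
  rw [Finset.abs_prod]
  apply Finset.prod_le_one fun i _ => abs_nonneg _
  intro i _
  rw [abs_pow]
  have h := hx i
  simp only [unitRect, mem_Ioo] at h
  exact pow_le_one₀ (abs_nonneg _) (by rw [abs_of_pos h.1]; exact h.2.le)

theorem Rect.exists_eval_eq_sum_mono (K : Rect d) {p : ℕ} {q : MvPolynomial (Fin d) ℝ}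
    (hq : q ∈ MvPolynomial.restrictDegree (Fin d) ℝ p) :
    ∃ a : (Fin d → Fin (p + 1)) → ℝ, ∀ x : EuclideanSpace ℝ (Fin d),
      MvPolynomial.eval (fun i => x i) q = ∑ I, a I * mono I (K.toUnit x) := by
  classical
  rw [MvPolynomial.mem_restrictDegree] at hq
  -- The binomial sum is padded to a common length `p + 1`; terms with `j > m` have a zero binomial
  -- coefficient, so truncated subtraction does no harm.
  have hbin : ∀ (l h : ℝ) (m : ℕ), m ≤ p → ∀ t : ℝ,
      (l + h * t) ^ m = ∑ j : Fin (p + 1), (h ^ (j : ℕ) * l ^ (m - j) * m.choose j) *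
        t ^ (j : ℕ) := by
    intro l h m hm t
    rw [Fin.sum_univ_eq_sum_range (fun j => (h ^ j * l ^ (m - j) * m.choose j) * t ^ j) (p + 1),
      add_comm, add_pow]
    rw [← Finset.sum_subset (Finset.range_mono (Nat.succ_le_succ hm))]
    · exact Finset.sum_congr rfl fun j _ => by ring
    · intro j _ hj
      rw [Nat.choose_eq_zero_of_lt (by simpa using hj)]
      simp
  refine ⟨fun I => ∑ m ∈ q.support, q.coeff m * ∏ i, ((K.upper i - K.lower i) ^ (I i : ℕ) *
    K.lower i ^ (m i - I i) * (m i).choose (I i)), fun x => ?_⟩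
  rw [MvPolynomial.eval_eq']
  simp_rw [Finset.sum_mul]
  rw [Finset.sum_comm]
  refine Finset.sum_congr rfl fun m hm => ?_
  have h1 : ∀ i, x i = K.lower i + (K.upper i - K.lower i) * K.toUnit x i := fun i => by
    rw [K.toUnit_apply, mul_div_cancel₀ _ (sub_pos.2 (K.lower_lt_upper i)).ne']
    ring
  have h2 : ∏ i, x i ^ m i = ∏ i, ∑ j : Fin (p + 1),
      ((K.upper i - K.lower i) ^ (j : ℕ) * K.lower i ^ (m i - j) * (m i).choose j) *
        K.toUnit x i ^ (j : ℕ) := by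
    refine Finset.prod_congr rfl fun i _ => ?_
    rw [← hbin _ _ _ (hq m hm i), ← h1]
  rw [h2, Finset.prod_univ_sum, Fintype.piFinset_univ, Finset.mul_sum]
  refine Finset.sum_congr rfl fun I _ => ?_
  rw [Finset.prod_mul_distrib, mono]
  ring

/-! ### Bubble functions with prescribed moments -/

/-- The dual functions are transported from the unit cube, which makes the constant depend on `d`
and `p` alone; the side length enters only as `h⁻¹` through the chain rule. -/
theorem exists_bubble (d p : ℕ) : ∃ C : ℝ, 0 ≤ C ∧ ∀ (K : Rect d) (h : ℝ), 0 < h →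
    (∀ i, h ≤ K.upper i - K.lower i) → ∀ f : EuclideanSpace ℝ (Fin d) → ℝ,
    MemLp f 2 (volume.restrict K.inner) → ∃ b ∈ testFunctions K.inner,
      (∀ q ∈ MvPolynomial.restrictDegree (Fin d) ℝ p,
        ∫ x in K.inner, b x * MvPolynomial.eval (fun i => x i) q =
          ∫ x in K.inner, f x * MvPolynomial.eval (fun i => x i) q) ∧
      ∫ x in K.inner, ‖∇ b x‖ ^ 2 ≤ (C * h⁻¹) ^ 2 * ∫ x in K.inner, f x ^ 2 := by
  classical
  obtain ⟨b, hb, hdual⟩ := exists_dual_testFunctions d p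
  have hM : ∀ J, ∃ M, ∀ x, ‖fderiv ℝ (b J) x‖ ≤ M := fun J =>
    ((hb J).2.1.fderiv (𝕜 := ℝ)).exists_bound_of_continuous
      ((hb J).1.continuous_fderiv (by simp))
  choose M hM using hM
  have hM0 : ∀ J, 0 ≤ M J := fun J => (norm_nonneg _).trans (hM J 0)
  set γ := volume.real (unitRect d).inner with hγ
  refine ⟨(∑ J, M J) * γ, mul_nonneg (Finset.sum_nonneg fun J _ => hM0 J) measureReal_nonneg, ?_⟩
  intro K h hh hK f hf
  obtain ⟨c, hc, hcK, hcint⟩ := K.exists_integral_comp_toUnit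
  have : IsFiniteMeasure (volume.restrict K.inner) :=
    ⟨by rw [Measure.restrict_apply_univ]; exact K.volume_inner_lt_top⟩
  have hbK : ∀ J, (fun x => b J (K.toUnit x)) ∈ testFunctions K.inner := by
    intro J
    refine ⟨(hb J).1.comp K.contDiff_toUnit, (hb J).2.1.comp_homeomorph K.toUnit, ?_⟩
    have h1 := tsupport_comp_eq_preimage (b J) K.toUnit
    intro x hx
    have h2 : K.toUnit x ∈ tsupport (b J) := by
      have : x ∈ tsupport (b J ∘ K.toUnit) := hx
      rw [h1] at this
      exact this
    exact K.toUnit_mem_inner.1 ((hb J).2.2 h2)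
  have hmonoc : ∀ I : Fin d → Fin (p + 1), Continuous fun x => mono I (K.toUnit x) :=
    fun I => (continuous_mono I).comp K.toUnit.continuous
  have hbound : ∀ (I : Fin d → Fin (p + 1)), ∀ x ∈ K.inner, |mono I (K.toUnit x)| ≤ 1 :=
    fun I x hx => abs_mono_le_one I (K.toUnit_mem_inner.2 hx)
  have hmonoL : ∀ I : Fin d → Fin (p + 1),
      MemLp (fun x => mono I (K.toUnit x)) 2 (volume.restrict K.inner) := fun I =>
    MemLp.of_bound (hmonoc I).aestronglyMeasurable 1
      ((ae_restrict_iff' K.isOpen_inner.measurableSet).2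
        (Filter.Eventually.of_forall fun x hx => hbound I x hx))
  set m : (Fin d → Fin (p + 1)) → ℝ := fun J => ∫ x in K.inner, f x * mono J (K.toUnit x) with hm
  set S := ∫ x in K.inner, f x ^ 2 with hS
  have hS0 : 0 ≤ S := integral_nonneg fun x => by positivity
  have hmb : ∀ J, |m J| ≤ √(volume.real K.inner * S) := by
    intro J
    apply Real.abs_le_sqrt
    refine (sq_integral_mul_le hf (hmonoL J)).trans ?_
    rw [mul_comm]
    gcongr
    have h1 : ∫ x in K.inner, mono J (K.toUnit x) ^ 2 ≤ ∫ x in K.inner, (1 : ℝ) := by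
      apply setIntegral_mono_on (hmonoL J).integrable_sq (integrable_const _)
        K.isOpen_inner.measurableSet
      intro x hx
      rw [sq_le_one_iff_abs_le_one]
      exact hbound J x hx
    simpa using h1
  -- Dual basis expansion with the moments of `f`; `c⁻¹` offsets the Jacobian in the transported
  -- duality relation.
  set B : EuclideanSpace ℝ (Fin d) → ℝ :=
    ∑ J, (c⁻¹ * m J) • (fun x => b J (K.toUnit x)) with hBdef
  have hB : B ∈ testFunctions K.inner :=
    Submodule.sum_mem _ fun J _ => Submodule.smul_mem _ _ (hbK J)
  refine ⟨B, hB, ?_, ?_⟩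
  · intro q hq
    obtain ⟨a, ha⟩ := K.exists_eval_eq_sum_mono hq
    simp_rw [ha]
    have h1 : ∫ x in K.inner, B x * ∑ I, a I * mono I (K.toUnit x) =
        ∫ x, B x * ∑ I, a I * mono I (K.toUnit x) := by
      apply setIntegral_eq_integral_of_forall_compl_eq_zero
      intro x hx
      rw [image_eq_zero_of_notMem_tsupport fun h => hx (hB.2.2 h), zero_mul]
    have h2 : ∀ I J, ∫ x, b J (K.toUnit x) * mono I (K.toUnit x) = if I = J then c else 0 := by
      intro I J
      rw [hcint (fun x => b J x * mono I x), hdual]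
      split_ifs <;> simp
    have hi : ∀ I J, Integrable fun x => b J (K.toUnit x) * mono I (K.toUnit x) :=
      fun I J => integrable_testFunction_mul (hbK J) (hmonoc I)
    have h3 : ∀ x, B x * ∑ I, a I * mono I (K.toUnit x) = ∑ I, ∑ J,
        (c⁻¹ * m J * a I) * (b J (K.toUnit x) * mono I (K.toUnit x)) := by
      intro x
      rw [hBdef, Finset.sum_apply, Finset.sum_mul_sum, Finset.sum_comm]
      refine Finset.sum_congr rfl fun I _ => Finset.sum_congr rfl fun J _ => ?_
      simp only [Pi.smul_apply, smul_eq_mul]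
      ring
    rw [h1]
    simp_rw [h3]
    rw [integral_finsetSum _ fun I _ =>
      integrable_finsetSum _ fun J _ => (hi I J).const_mul _]
    have h4 : ∫ x in K.inner, f x * ∑ I, a I * mono I (K.toUnit x) = ∑ I, a I * m I := by
      simp_rw [Finset.mul_sum, mul_left_comm (f _)]
      rw [integral_finsetSum]
      · simp_rw [integral_const_mul]
        rfl
      · intro I _
        exact (hf.integrable_mul (hmonoL I)).const_mul _
    rw [h4]
    refine Finset.sum_congr rfl fun I _ => ?_
    rw [integral_finsetSum _ fun J _ => (hi I J).const_mul _]
    simp_rw [integral_const_mul, h2]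
    rw [Finset.sum_eq_single I]
    · rw [if_pos rfl]
      field_simp
    · intro J _ hJ
      rw [if_neg (Ne.symm hJ), mul_zero]
    · simp
  · have hgrad : ∀ x, ‖∇ B x‖ ≤ c⁻¹ * √(volume.real K.inner * S) * (∑ J, M J) * h⁻¹ := by
      intro x
      rw [norm_gradient]
      have h1 : fderiv ℝ B x =
          ∑ J, (c⁻¹ * m J) • fderiv ℝ (fun x => b J (K.toUnit x)) x := by
        rw [hBdef, fderiv_sum fun J _ =>
          ((hbK J).1.differentiable (by simp) x).const_smul _]
        refine Finset.sum_congr rfl fun J _ => ?_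
        exact fderiv_const_smul ((hbK J).1.differentiable (by simp) x) _
      rw [h1, Finset.mul_sum, Finset.sum_mul]
      refine (norm_sum_le _ _).trans (Finset.sum_le_sum fun J _ => ?_)
      rw [norm_smul, norm_mul, Real.norm_of_nonneg (inv_nonneg.2 hc.le), Real.norm_eq_abs,
        mul_assoc _ (M J)]
      have h2 := K.norm_fderiv_comp_toUnit_le hh hK (hb J).1 (hM J) x
      have h3 := hmb J
      gcongr
    have h1 : ∫ x in K.inner, ‖∇ B x‖ ^ 2 ≤ ∫ x in K.inner,
        (c⁻¹ * √(volume.real K.inner * S) * (∑ J, M J) * h⁻¹) ^ 2 := by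
      apply integral_mono
      · have hcg := continuous_gradient hB.1
        exact ((hcg.norm.pow 2).continuousOn.integrableOn_compact K.isCompact_closed).mono_set
          K.inner_subset_closed
      · exact integrable_const _
      · intro x
        have := hgrad x
        dsimp only
        gcongr
    -- Two factors of the cell volume appear, one from the moments and one from integrating a
    -- constant; they cancel `c⁻¹ ^ 2` up to `γ ^ 2`.
    refine h1.trans (le_of_eq ?_)
    rw [integral_const, measureReal_restrict_apply_univ, smul_eq_mul]
    simp only [mul_pow]
    rw [Real.sq_sqrt (by positivity), hcK, ← hγ]
    field_simp

/-! ### Smooth cutoff functions -/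

/-- Mollify a ramp in the distance to `S`. Averaging preserves its slope `2 / ρ`, and the kernel
radius `ρ / 4` fits into the margins where the ramp is constant. -/
theorem exists_smooth_cutoff (S : Set (EuclideanSpace ℝ (Fin d))) {ρ : ℝ}
    (hρ : 0 < ρ) : ∃ η : EuclideanSpace ℝ (Fin d) → ℝ, ContDiff ℝ ∞ η ∧ (∀ x, |η x| ≤ 1) ∧
      (∀ x ∈ S, η x = 0) ∧ (∀ x, ρ ≤ Metric.infDist x S → η x = 1) ∧
      ∀ x, ‖∇ η x‖ ≤ 2 / ρ := by
  -- The ramp is zero up to distance `ρ / 4` and one from distance `3 * ρ / 4` on.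
  set f : EuclideanSpace ℝ (Fin d) → ℝ :=
    fun x => max 0 (min 1 ((Metric.infDist x S - ρ / 4) * (2 / ρ))) with hf
  have hfc : Continuous f := by
    have := Metric.continuous_infDist_pt S
    fun_prop
  have hf1 : ∀ x, ‖f x‖ ≤ 1 := fun x => by
    rw [Real.norm_eq_abs, abs_of_nonneg (le_max_left _ _)]
    exact max_le zero_le_one (min_le_left _ _)
  have hflip : ∀ x y, ‖f x - f y‖ ≤ 2 / ρ * ‖x - y‖ := by
    intro x y
    have h1 : |Metric.infDist x S - Metric.infDist y S| ≤ ‖x - y‖ := by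
      have := (Metric.lipschitz_infDist_pt S).dist_le_mul x y
      simpa [Real.dist_eq, dist_eq_norm] using this
    have h2 : |f x - f y| ≤ |(Metric.infDist x S - ρ / 4) * (2 / ρ) -
        (Metric.infDist y S - ρ / 4) * (2 / ρ)| := by
      refine (abs_max_sub_max_le_max _ _ _ _).trans (max_le (by simp) ?_)
      exact (abs_min_sub_min_le_max _ _ _ _).trans (max_le (by simp) le_rfl)
    rw [Real.norm_eq_abs]
    refine h2.trans ?_
    rw [← sub_mul, sub_sub_sub_cancel_right, abs_mul, abs_of_pos (by positivity : 0 < 2 / ρ),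
      mul_comm]
    gcongr
  let φ : ContDiffBump (0 : EuclideanSpace ℝ (Fin d)) :=
    ⟨ρ / 8, ρ / 4, by positivity, by linarith⟩
  have hφi : Integrable (φ.normed volume) := φ.integrable_normed
  set η := convolution (φ.normed volume) f (ContinuousLinearMap.lsmul ℝ ℝ) volume with hη
  have hηx : ∀ x, η x = ∫ t, φ.normed volume t * f (x - t) := fun x => by
    rw [hη, convolution_def]; rfl
  have hint : ∀ x, Integrable fun t => φ.normed volume t * f (x - t) := by
    intro x
    apply (φ.continuous_normed.mul (hfc.comp (by fun_prop))).integrable_of_hasCompactSupport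
    exact φ.hasCompactSupport_normed.mul_right
  have hφ0 : ∀ t, 0 ≤ φ.normed volume t := φ.nonneg_normed
  have hηs : ContDiff ℝ ∞ η :=
    φ.hasCompactSupport_normed.contDiff_convolution_left _ φ.contDiff_normed
      hfc.locallyIntegrable
  have hlip : ∀ x y, ‖η x - η y‖ ≤ 2 / ρ * ‖x - y‖ := by
    intro x y
    rw [hηx, hηx, ← integral_sub (hint x) (hint y)]
    have h1 : ∫ t, φ.normed volume t * (2 / ρ * ‖x - y‖) = 2 / ρ * ‖x - y‖ := by
      rw [integral_mul_const, φ.integral_normed, one_mul]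
    rw [← h1]
    refine norm_integral_le_of_norm_le (hφi.mul_const _) (Filter.Eventually.of_forall fun t => ?_)
    rw [← mul_sub, norm_mul, Real.norm_of_nonneg (hφ0 t)]
    have h2 := hflip (x - t) (y - t)
    rw [sub_sub_sub_cancel_right] at h2
    exact mul_le_mul_of_nonneg_left h2 (hφ0 t)
  refine ⟨η, hηs, ?_, ?_, ?_, ?_⟩
  · intro x
    rw [hηx, ← Real.norm_eq_abs]
    have h1 : ∫ t, φ.normed volume t = 1 := φ.integral_normed
    rw [← h1]
    refine norm_integral_le_of_norm_le hφi (Filter.Eventually.of_forall fun t => ?_)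
    rw [norm_mul, Real.norm_of_nonneg (hφ0 t)]
    exact mul_le_of_le_one_right (hφ0 t) (hf1 _)
  · intro x hx
    have hball : ∀ y ∈ Metric.ball x (ρ / 4), f y = 0 := by
      intro y hy
      have h1 : Metric.infDist y S ≤ dist y x := Metric.infDist_le_dist_of_mem hx
      have h2 := Metric.mem_ball.1 hy
      rw [hf]
      refine max_eq_left ((min_le_right _ _).trans ?_)
      exact mul_nonpos_of_nonpos_of_nonneg (by linarith) (by positivity)
    have h0 : f x = 0 := hball x (Metric.mem_ball_self (by positivity))
    have h3 := φ.normed_convolution_eq_right (μ := volume) (g := f) (x₀ := x)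
      fun y hy => (hball y hy).trans h0.symm
    rw [hη, h3, h0]
  · intro x hx
    have hball : ∀ y ∈ Metric.ball x (ρ / 4), f y = 1 := by
      intro y hy
      have h1 : Metric.infDist x S ≤ Metric.infDist y S + dist x y :=
        Metric.infDist_le_infDist_add_dist
      have h2 := Metric.mem_ball'.1 hy
      have h3 : 1 ≤ (Metric.infDist y S - ρ / 4) * (2 / ρ) := by
        rw [← mul_div_assoc, le_div_iff₀ hρ]
        linarith
      simp only [hf]
      rw [min_eq_left h3]
      simp
    have h0 : f x = 1 := hball x (Metric.mem_ball_self (by positivity))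
    have h3 := φ.normed_convolution_eq_right (μ := volume) (g := f) (x₀ := x)
      fun y hy => (hball y hy).trans h0.symm
    rw [hη, h3, h0]
  · intro x
    rw [norm_gradient]
    have h1 : LipschitzWith (Real.toNNReal (2 / ρ)) η := LipschitzWith.of_dist_le_mul fun x y => by
      rw [dist_eq_norm, dist_eq_norm, Real.coe_toNNReal _ (by positivity)]
      exact hlip x y
    have h2 := norm_fderiv_le_of_lipschitz ℝ h1 (x₀ := x)
    rwa [Real.coe_toNNReal _ (by positivity)] at h2

/-! ### Multiplication by smooth functions in `H¹₀` -/

theorem gradient_mul {η φ : EuclideanSpace ℝ (Fin d) → ℝ} (hη : ContDiff ℝ ∞ η)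
    (hφ : ContDiff ℝ ∞ φ) (x : EuclideanSpace ℝ (Fin d)) :
    ∇ (fun y => η y * φ y) x = η x • ∇ φ x + φ x • ∇ η x := by
  simp only [gradient]
  rw [fderiv_fun_mul (hη.differentiable (by simp) x) (hφ.differentiable (by simp) x)]
  simp

/-- The product rule defines a continuous map on pairs because `η` and `∇ η` are bounded. It sends
test pairs to test pairs, hence their closure into itself. -/
theorem exists_smul_mem_H10 {η : EuclideanSpace ℝ (Fin d) → ℝ} (hη : ContDiff ℝ ∞ η) {a L : ℝ}
    (hηa : ∀ x, |η x| ≤ a) (hηL : ∀ x, ‖∇ η x‖ ≤ L) {z : L2Pair Ω} (hz : z ∈ H10 Ω) :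
    ∃ w ∈ H10 Ω, (w.fst =ᵐ[volume.restrict Ω] fun x => η x * z.fst x) ∧
      w.snd =ᵐ[volume.restrict Ω] fun x => η x • z.snd x + z.fst x • ∇ η x := by
  have m1 : MemLp η ⊤ (volume.restrict Ω) :=
    memLp_top_of_bound hη.continuous.aestronglyMeasurable a (Filter.Eventually.of_forall hηa)
  have m2 : MemLp (∇ η) ⊤ (volume.restrict Ω) :=
    memLp_top_of_bound (continuous_gradient hη).aestronglyMeasurable L
      (Filter.Eventually.of_forall hηL)
  let T₁ : L2 Ω →L[ℝ] L2 Ω :=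
    (ContinuousLinearMap.lsmul ℝ ℝ : ℝ →L[ℝ] ℝ →L[ℝ] ℝ).holderL (volume.restrict Ω) ⊤ 2 2
      (m1.toLp η)
  let T₂ : Lp (EuclideanSpace ℝ (Fin d)) 2 (volume.restrict Ω) →L[ℝ]
      Lp (EuclideanSpace ℝ (Fin d)) 2 (volume.restrict Ω) :=
    (ContinuousLinearMap.lsmul ℝ ℝ : ℝ →L[ℝ] EuclideanSpace ℝ (Fin d) →L[ℝ] _).holderL
      (volume.restrict Ω) ⊤ 2 2 (m1.toLp η)
  let T₃ : L2 Ω →L[ℝ] Lp (EuclideanSpace ℝ (Fin d)) 2 (volume.restrict Ω) :=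
    (ContinuousLinearMap.lsmul ℝ ℝ : ℝ →L[ℝ] EuclideanSpace ℝ (Fin d) →L[ℝ] _).flip.holderL
      (volume.restrict Ω) ⊤ 2 2 (m2.toLp (∇ η))
  have e1 : ∀ u, T₁ u =ᵐ[volume.restrict Ω] fun x => η x * u x := by
    intro u
    filter_upwards [ContinuousLinearMap.coeFn_holder (r := 2)
      (ContinuousLinearMap.lsmul ℝ ℝ : ℝ →L[ℝ] ℝ →L[ℝ] ℝ) (m1.toLp η) u, m1.coeFn_toLp]
      with x h1 h2
    refine h1.trans ?_
    rw [h2]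
    rfl
  have e2 : ∀ u, T₂ u =ᵐ[volume.restrict Ω] fun x => η x • u x := by
    intro u
    filter_upwards [ContinuousLinearMap.coeFn_holder (r := 2)
      (ContinuousLinearMap.lsmul ℝ ℝ : ℝ →L[ℝ] EuclideanSpace ℝ (Fin d) →L[ℝ] _)
      (m1.toLp η) u, m1.coeFn_toLp] with x h1 h2
    refine h1.trans ?_
    rw [h2]
    rfl
  have e3 : ∀ u, T₃ u =ᵐ[volume.restrict Ω] fun x => u x • ∇ η x := by
    intro u
    filter_upwards [ContinuousLinearMap.coeFn_holder (r := 2)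
      (ContinuousLinearMap.lsmul ℝ ℝ : ℝ →L[ℝ] EuclideanSpace ℝ (Fin d) →L[ℝ] _).flip
      (m2.toLp (∇ η)) u, m2.coeFn_toLp] with x h1 h2
    refine h1.trans ?_
    rw [h2]
    rfl
  let T : L2Pair Ω → L2Pair Ω := fun z => WithLp.toLp 2 (T₁ z.fst, T₂ z.snd + T₃ z.fst)
  have hT : Continuous T := by
    refine (WithLp.prod_continuous_toLp 2 _ _).comp (Continuous.prodMk ?_ ?_)
    · exact T₁.continuous.comp (continuous_fst.comp (WithLp.prod_continuous_ofLp ..))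
    · exact (T₂.continuous.comp (continuous_snd.comp (WithLp.prod_continuous_ofLp ..))).add
        (T₃.continuous.comp (continuous_fst.comp (WithLp.prod_continuous_ofLp ..)))
  have hTz : ∀ z, ((T z).fst =ᵐ[volume.restrict Ω] fun x => η x * z.fst x) ∧
      (T z).snd =ᵐ[volume.restrict Ω] fun x => η x • z.snd x + z.fst x • ∇ η x := by
    intro z
    refine ⟨e1 _, ?_⟩
    filter_upwards [Lp.coeFn_add (T₂ z.snd) (T₃ z.fst), e2 z.snd, e3 z.fst] with x h1 h2 h3
    refine h1.trans ?_
    rw [Pi.add_apply, h2, h3]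
  refine ⟨T z, ?_, hTz z⟩
  refine map_mem_closure hT hz ?_
  rintro u ⟨φ, hφ, hφc, hφs, h1, h2⟩
  refine ⟨fun x => η x * φ x, hη.mul hφ, hφc.mul_left,
    (closure_mono (Function.support_mul_subset_right η φ)).trans hφs, ?_, ?_⟩
  · filter_upwards [(hTz u).1, h1] with x h3 h4
    rw [h3, h4]
  · filter_upwards [(hTz u).2, h1, h2] with x h3 h4 h5
    rw [h3, h4, h5, gradient_mul hη hφ]

theorem exists_pair_of_testFunction {U : Set (EuclideanSpace ℝ (Fin d))} (hU : U ⊆ Ω)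
    {b : EuclideanSpace ℝ (Fin d) → ℝ} (hb : b ∈ testFunctions U) :
    ∃ w ∈ H10 Ω, (w.fst =ᵐ[volume.restrict Ω] b) ∧ w.snd =ᵐ[volume.restrict Ω] ∇ b := by
  have hgc : HasCompactSupport (∇ b) :=
    (hb.2.1.fderiv (𝕜 := ℝ)).comp_left (map_zero (InnerProductSpace.toDual ℝ _).symm)
  have m1 : MemLp b 2 (volume.restrict Ω) :=
    (hb.1.continuous.memLp_of_hasCompactSupport hb.2.1).restrict _
  have m2 : MemLp (∇ b) 2 (volume.restrict Ω) :=
    ((continuous_gradient hb.1).memLp_of_hasCompactSupport hgc).restrict _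
  refine ⟨WithLp.toLp 2 (m1.toLp b, m2.toLp (∇ b)), ?_, m1.coeFn_toLp, m2.coeFn_toLp⟩
  exact Submodule.le_topologicalClosure _
    ⟨b, hb.1, hb.2.1, hb.2.2.trans hU, m1.coeFn_toLp, m2.coeFn_toLp⟩

/-! ### The kernel of the projection, cell by cell -/

theorem restrict_restrict_closed (T : RectMesh Ω) {K : Rect d} (hK : K ∈ T.cells) :
    (volume.restrict Ω).restrict K.closed = volume.restrict K.inner := by
  rw [Measure.restrict_restrict K.isClosed_closed.measurableSet, inter_comm]
  exact Measure.restrict_congr_set (T.inter_closed_ae_eq hK)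

theorem continuous_polyEval (q : MvPolynomial (Fin d) ℝ) :
    Continuous fun x : EuclideanSpace ℝ (Fin d) => MvPolynomial.eval (fun i => x i) q :=
  (MvPolynomial.continuous_eval q).comp (by fun_prop)

theorem memLp_indicator_polyEval (K : Rect d) (q : MvPolynomial (Fin d) ℝ)
    (μ : Measure (EuclideanSpace ℝ (Fin d))) [IsFiniteMeasureOnCompacts μ] :
    MemLp (K.inner.indicator fun x => MvPolynomial.eval (fun i => x i) q) 2 μ := by
  rw [memLp_indicator_iff_restrict K.isOpen_inner.measurableSet]
  obtain ⟨C, hC⟩ := K.isCompact_closed.exists_bound_of_continuousOn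
    (continuous_polyEval q).continuousOn
  have : IsFiniteMeasure (μ.restrict K.inner) := ⟨by
    rw [Measure.restrict_apply_univ]
    exact (measure_mono K.inner_subset_closed).trans_lt K.isCompact_closed.measure_lt_top⟩
  exact MemLp.of_bound (continuous_polyEval q).aestronglyMeasurable C
    ((ae_restrict_iff' K.isOpen_inner.measurableSet).2
      (Filter.Eventually.of_forall fun x hx => hC x (K.inner_subset_closed hx)))

/-- A polynomial on one cell extended by zero belongs to `V_H`, so the projection condition
decouples. This locality is what allows cutoffs to be repaired cell by cell. -/
theorem RectMesh.mem_kernelSpace_iff (T : RectMesh Ω) {p : ℕ} {w : L2Pair Ω} :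
    w ∈ T.kernelSpace p ↔ w ∈ H10 Ω ∧ ∀ K ∈ T.cells,
      ∀ q ∈ MvPolynomial.restrictDegree (Fin d) ℝ p,
        ∫ x in K.inner, w.fst x * MvPolynomial.eval (fun i => x i) q = 0 := by
  have h0 : w ∈ T.kernelSpace p ↔ w ∈ H10 Ω ∧ w.fst ∈ (T.polySpace p)ᗮ := by
    rw [← Submodule.starProjection_apply_eq_zero_iff]
    rfl
  rw [h0, Submodule.mem_orthogonal]
  refine and_congr_right fun _ => ⟨fun h K hK q hq => ?_, fun h v hv => ?_⟩
  · have m := memLp_indicator_polyEval K q (volume.restrict Ω)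
    have hmem : m.toLp _ ∈ T.polySpace p := by
      intro L hL
      rw [restrict_restrict_closed T hL]
      have e := ae_mono (T.restrict_inner_le hL) m.coeFn_toLp
      by_cases hKL : K = L
      · subst hKL
        refine ⟨q, hq, ?_⟩
        filter_upwards [e, ae_restrict_mem K.isOpen_inner.measurableSet] with x h1 h2
        rw [h1, indicator_of_mem h2]
      · refine ⟨0, zero_mem _, ?_⟩
        filter_upwards [e, ae_restrict_mem L.isOpen_inner.measurableSet] with x h1 h2
        rw [h1, indicator_of_notMem (disjoint_right.1 (T.inner_disjoint K hK L hL hKL) h2),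
          map_zero]
    rw [← h _ hmem, L2.inner_def, ← restrict_restrict_inner T hK,
      ← integral_indicator K.isOpen_inner.measurableSet]
    apply integral_congr_ae
    filter_upwards [m.coeFn_toLp] with x hx
    rw [hx]
    by_cases hxK : x ∈ K.inner
    · rw [indicator_of_mem hxK, indicator_of_mem hxK]
      rfl
    · rw [indicator_of_notMem hxK, indicator_of_notMem hxK, inner_zero_left]
  · rw [L2.inner_def, T.integral_eq_sum (L2.integrable_inner _ _)]
    refine Finset.sum_eq_zero fun K hK => ?_
    obtain ⟨q, hq, hvq⟩ := hv K hK
    rw [restrict_restrict_closed T hK] at hvq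
    rw [← h K hK q hq]
    apply integral_congr_ae
    filter_upwards [hvq] with x hx
    rw [hx]
    rfl

/-! ### Existence and uniqueness of the corrector -/

theorem integral_norm_sq_eq {X F : Type*} [MeasurableSpace X] {μ : Measure X}
    [NormedAddCommGroup F] [InnerProductSpace ℝ F] (f : Lp F 2 μ) :
    ∫ x, ‖f x‖ ^ 2 ∂μ = ‖f‖ ^ 2 := by
  rw [← real_inner_self_eq_norm_sq, L2.inner_def]
  simp_rw [real_inner_self_eq_norm_sq]

theorem integrable_norm_sq {X F : Type*} [MeasurableSpace X] {μ : Measure X}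
    [NormedAddCommGroup F] (f : Lp F 2 μ) : Integrable (fun x => ‖f x‖ ^ 2) μ :=
  (Lp.memLp f).integrable_norm_pow (by norm_num)

/-- Testing with `q = 1` gives mean zero on the cell, so the mean term in Poincaré's inequality
drops out. -/
theorem RectMesh.poincare_kernelSpace (T : RectMesh Ω) {p : ℕ} {w : L2Pair Ω}
    (hw : w ∈ T.kernelSpace p) {K : Rect d} (hK : K ∈ T.cells) :
    ∫ x in K.inner, w.fst x ^ 2 ≤
      2 ^ d * Metric.diam K.closed ^ 2 * ∫ x in K.inner, ‖w.snd x‖ ^ 2 := by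
  rw [T.mem_kernelSpace_iff] at hw
  have h1 := hw.2 K hK 1 (by
    rw [MvPolynomial.mem_restrictDegree]
    intro s hs i
    have : s = 0 := by
      by_contra hne
      rw [MvPolynomial.mem_support_iff, MvPolynomial.coeff_one, if_neg (Ne.symm hne)] at hs
      exact hs rfl
    simp [this])
  simp only [map_one, mul_one] at h1
  have h2 := poincare_H10 hw.1 (T.inner_subset K hK)
  rw [h1] at h2
  refine le_of_mul_le_mul_left ?_ K.volume_real_inner_pos
  linarith

/-- Bounded measurable coefficients. -/
structure IsCoefficient (Ω : Set (EuclideanSpace ℝ (Fin d))) (α β : ℝ)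
    (A : EuclideanSpace ℝ (Fin d) → ℝ) : Prop where
  aesm : AEStronglyMeasurable A (volume.restrict Ω)
  bounds : ∀ᵐ x ∂volume.restrict Ω, α ≤ A x ∧ A x ≤ β

namespace IsCoefficient

variable {α β : ℝ} {A : EuclideanSpace ℝ (Fin d) → ℝ}

theorem abs_le (hA : IsCoefficient Ω α β A) (hα : 0 < α) :
    ∀ᵐ x ∂volume.restrict Ω, ‖A x‖ ≤ β := by
  filter_upwards [hA.bounds] with x hx
  rw [Real.norm_of_nonneg (by linarith)]
  exact hx.2

theorem integrable (hA : IsCoefficient Ω α β A) (hα : 0 < α) (u w : L2Pair Ω) :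
    Integrable (fun x => A x * inner ℝ (u.snd x) (w.snd x)) (volume.restrict Ω) :=
  (L2.integrable_inner u.snd w.snd).bdd_mul hA.aesm (hA.abs_le hα)

theorem energyForm_add_left (hA : IsCoefficient Ω α β A) (hα : 0 < α) (u v w : L2Pair Ω) :
    energyForm A (u + v) w = energyForm A u w + energyForm A v w := by
  unfold energyForm
  rw [← integral_add (hA.integrable hα u w) (hA.integrable hα v w)]
  apply integral_congr_ae
  filter_upwards [Lp.coeFn_add u.snd v.snd] with x hx
  have : (u + v).snd x = u.snd x + v.snd x := hx
  rw [this, inner_add_left, mul_add]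

theorem energyForm_add_right (hA : IsCoefficient Ω α β A) (hα : 0 < α) (u v w : L2Pair Ω) :
    energyForm A u (v + w) = energyForm A u v + energyForm A u w := by
  unfold energyForm
  rw [← integral_add (hA.integrable hα u v) (hA.integrable hα u w)]
  apply integral_congr_ae
  filter_upwards [Lp.coeFn_add v.snd w.snd] with x hx
  have : (v + w).snd x = v.snd x + w.snd x := hx
  rw [this, inner_add_right, mul_add]

theorem energyForm_smul_left (c : ℝ) (u w : L2Pair Ω) :
    energyForm A (c • u) w = c * energyForm A u w := by
  unfold energyForm
  rw [← integral_const_mul]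
  apply integral_congr_ae
  filter_upwards [Lp.coeFn_smul c u.snd] with x hx
  have : (c • u).snd x = c • u.snd x := hx
  rw [this, real_inner_smul_left, mul_left_comm]

theorem energyForm_smul_right (c : ℝ) (u w : L2Pair Ω) :
    energyForm A u (c • w) = c * energyForm A u w := by
  unfold energyForm
  rw [← integral_const_mul]
  apply integral_congr_ae
  filter_upwards [Lp.coeFn_smul c w.snd] with x hx
  have : (c • w).snd x = c • w.snd x := hx
  rw [this, real_inner_smul_right, mul_left_comm]

theorem abs_energyForm_le (hA : IsCoefficient Ω α β A) (hα : 0 < α) (hβ : 0 ≤ β)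
    (u w : L2Pair Ω) : |energyForm A u w| ≤ β * ‖u‖ * ‖w‖ := by
  have hs : ∀ z : L2Pair Ω, ‖z.snd‖ ≤ ‖z‖ := fun z => WithLp.norm_snd_le _ z
  have hAm : MemLp (fun x => A x • u.snd x) 2 (volume.restrict Ω) :=
    (Lp.memLp u.snd).of_le_mul (hA.aesm.smul (Lp.aestronglyMeasurable _)) (c := β) (by
      filter_upwards [hA.abs_le hα] with x hx
      rw [norm_smul]
      gcongr)
  have h1 : energyForm A u w ^ 2 ≤ (β * ‖u.snd‖ * ‖w.snd‖) ^ 2 := by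
    have h2 := sq_integral_inner_le hAm (Lp.memLp w.snd)
    simp only [real_inner_smul_left] at h2
    refine h2.trans ?_
    rw [integral_norm_sq_eq, mul_pow, mul_pow, ← integral_norm_sq_eq u.snd, ← integral_const_mul]
    refine mul_le_mul_of_nonneg_right (integral_mono_ae ?_ ?_ ?_) (by positivity)
    · exact hAm.integrable_norm_pow (by norm_num)
    · exact (integrable_norm_sq u.snd).const_mul _
    · filter_upwards [hA.abs_le hα] with x hx
      rw [norm_smul, mul_pow]
      gcongr
  refine (abs_le_of_sq_le_sq h1 (by positivity)).trans' le_rfl |>.trans ?_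
  gcongr
  · exact hs u
  · exact hs w

theorem le_energyForm_self (hA : IsCoefficient Ω α β A) (hα : 0 < α) (u : L2Pair Ω) :
    α * ‖u.snd‖ ^ 2 ≤ energyForm A u u := by
  rw [← integral_norm_sq_eq, ← integral_const_mul]
  refine integral_mono_ae ((integrable_norm_sq u.snd).const_mul _) (hA.integrable hα u u) ?_
  filter_upwards [hA.bounds] with x hx
  rw [real_inner_self_eq_norm_sq]
  exact mul_le_mul_of_nonneg_right hx.1 (by positivity)

end IsCoefficient

/-- Makes the energy form coercive for the full norm on `W`. The constant depends on the mesh and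
serves only solvability, never the decay rate. -/
theorem RectMesh.exists_norm_sq_le (T : RectMesh Ω) (p : ℕ) : ∃ P : ℝ, 0 ≤ P ∧
    ∀ w ∈ T.kernelSpace p, ‖w‖ ^ 2 ≤ (1 + P) * ‖w.snd‖ ^ 2 := by
  refine ⟨∑ K ∈ T.cells, 2 ^ d * Metric.diam K.closed ^ 2,
    Finset.sum_nonneg fun K _ => by positivity, fun w hw => ?_⟩
  rw [WithLp.prod_norm_sq_eq_of_L2, add_mul, one_mul, add_comm (‖w.snd‖ ^ 2)]
  gcongr
  rw [← integral_norm_sq_eq w.fst, T.integral_eq_sum (integrable_norm_sq w.fst), Finset.sum_mul]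
  refine Finset.sum_le_sum fun K hK => ?_
  have h1 := T.poincare_kernelSpace hw hK
  simp only [Real.norm_eq_abs, sq_abs]
  refine h1.trans ?_
  gcongr
  rw [← integral_norm_sq_eq]
  exact setIntegral_mono_set (integrable_norm_sq w.snd)
    (Filter.Eventually.of_forall fun x => by positivity)
    (T.inner_subset K hK).eventuallyLE

theorem RectMesh.isClosed_kernelSpace (T : RectMesh Ω) (p : ℕ) :
    IsClosed (T.kernelSpace p : Set (L2Pair Ω)) := by
  refine (Submodule.isClosed_topologicalClosure _).inter ?_
  have hc : Continuous fun z : L2Pair Ω => T.l2Proj p z.fst :=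
    (T.l2Proj p).continuous.comp (continuous_fst.comp (WithLp.prod_continuous_ofLp ..))
  exact isClosed_singleton.preimage hc

/-- The Lax–Milgram theorem for a bounded bilinear form. -/
theorem existsUnique_of_coercive {V : Type*} [NormedAddCommGroup V] [InnerProductSpace ℝ V]
    [CompleteSpace V] (a : V →ₗ[ℝ] V →ₗ[ℝ] ℝ) {C c : ℝ} (hC : ∀ u w, |a u w| ≤ C * ‖u‖ * ‖w‖)
    (hc : 0 < c) (hco : ∀ u, c * ‖u‖ * ‖u‖ ≤ a u u) (ℓ : V →L[ℝ] ℝ) :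
    ∃! u, ∀ w, a u w = ℓ w := by
  let B : V →L[ℝ] V →L[ℝ] ℝ := LinearMap.mkContinuous₂ a C hC
  have hB : ∀ u w, B u w = a u w := fun u w => rfl
  have hcoer : IsCoercive B := ⟨c, hc, hco⟩
  refine ⟨hcoer.continuousLinearEquivOfBilin.symm ((InnerProductSpace.toDual ℝ V).symm ℓ),
    fun w => ?_, fun χ hχ => ?_⟩
  · rw [← hB, ← hcoer.continuousLinearEquivOfBilin_apply, ContinuousLinearEquiv.apply_symm_apply,
      InnerProductSpace.toDual_symm_apply]
  · rw [ContinuousLinearEquiv.eq_symm_apply]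
    refine (hcoer.unique_continuousLinearEquivOfBilin fun w => ?_).symm
    rw [InnerProductSpace.toDual_symm_apply, hB, hχ]

theorem RectMesh.exists_load (T : RectMesh Ω) (p : ℕ) (G : Rect d) (v : L2 Ω) :
    ∃ ℓ : T.kernelSpace p →L[ℝ] ℝ, ∀ w : T.kernelSpace p,
      ℓ w = -∫ x in Ω ∩ G.closed, v x * (w : L2Pair Ω).fst x := by
  have hmG : MemLp (G.closed.indicator v) 2 (volume.restrict Ω) :=
    (Lp.memLp v).indicator G.isClosed_closed.measurableSet
  refine ⟨-((innerSL ℝ (hmG.toLp _)).comp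
    ((WithLp.fstL 2 ℝ _ _).comp (T.kernelSpace p).subtypeL)), fun w => ?_⟩
  change -inner ℝ (hmG.toLp _) (w : L2Pair Ω).fst = _
  rw [L2.inner_def, inter_comm, ← Measure.restrict_restrict G.isClosed_closed.measurableSet,
    ← integral_indicator G.isClosed_closed.measurableSet]
  congr 1
  apply integral_congr_ae
  filter_upwards [hmG.coeFn_toLp] with x hx
  rw [hx]
  by_cases hxG : x ∈ G.closed
  · rw [indicator_of_mem hxG, indicator_of_mem hxG]
    exact mul_comm _ _
  · rw [indicator_of_notMem hxG, indicator_of_notMem hxG, inner_zero_left]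

theorem RectMesh.existsUnique_isEnrichedCorrection (T : RectMesh Ω) (p : ℕ) {α β : ℝ}
    (hα : 0 < α) (hβ : 0 ≤ β) {A : EuclideanSpace ℝ (Fin d) → ℝ} (hA : IsCoefficient Ω α β A)
    (G : Rect d) (v : L2 Ω) : ∃! ψ : L2Pair Ω, T.IsEnrichedCorrection p A G v ψ := by
  obtain ⟨P, hP, hnorm⟩ := T.exists_norm_sq_le p
  have hP' : (0 : ℝ) < 1 + P := by linarith
  have : CompleteSpace (T.kernelSpace p) := (T.isClosed_kernelSpace p).completeSpace_coe
  obtain ⟨ℓ, hℓ⟩ := T.exists_load p G v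
  have hco : ∀ u : T.kernelSpace p, α / (1 + P) * ‖u‖ * ‖u‖ ≤ energyForm A (u : L2Pair Ω) u := by
    intro u
    refine le_trans ?_ (hA.le_energyForm_self hα u)
    rw [mul_assoc, ← sq, div_mul_eq_mul_div, div_le_iff₀ hP', mul_assoc]
    exact mul_le_mul_of_nonneg_left ((hnorm u u.2).trans (le_of_eq (mul_comm _ _))) hα.le
  obtain ⟨ψ, hψ, huniq⟩ := existsUnique_of_coercive (V := T.kernelSpace p)
    (LinearMap.mk₂ ℝ (fun u w => energyForm A (u : L2Pair Ω) w)
      (fun u v w => hA.energyForm_add_left hα u v w)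
      (fun c u w => IsCoefficient.energyForm_smul_left c (u : L2Pair Ω) w)
      (fun u v w => hA.energyForm_add_right hα (u : L2Pair Ω) v w)
      (fun c u w => IsCoefficient.energyForm_smul_right c (u : L2Pair Ω) w))
    (fun u w => hA.abs_energyForm_le hα hβ (u : L2Pair Ω) w) (by positivity) hco ℓ
  refine ⟨ψ, ⟨ψ.2, fun w hw => (hψ ⟨w, hw⟩).trans (hℓ ⟨w, hw⟩)⟩, ?_⟩
  rintro χ ⟨hχ, hχ'⟩
  exact congrArg Subtype.val (huniq ⟨χ, hχ⟩ fun w => (hχ' w w.2).trans (hℓ w).symm)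

/-! ### Local corrections of moments -/

theorem gradient_eq_zero_of_notMem_tsupport {b : EuclideanSpace ℝ (Fin d) → ℝ}
    {x : EuclideanSpace ℝ (Fin d)} (hx : x ∉ tsupport b) : ∇ b x = 0 := by
  rw [gradient, fderiv_of_notMem_tsupport ℝ hx, map_zero]

theorem gradient_eq_zero_of_eqOn_const {η : EuclideanSpace ℝ (Fin d) → ℝ}
    {U : Set (EuclideanSpace ℝ (Fin d))} (hU : IsOpen U) {c : ℝ} (h : ∀ x ∈ U, η x = c)
    {x : EuclideanSpace ℝ (Fin d)} (hx : x ∈ U) : ∇ η x = 0 := by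
  have h1 : η =ᶠ[nhds x] fun _ => c := by
    filter_upwards [hU.mem_nhds hx] with y hy using h y hy
  rw [gradient, h1.fderiv_eq, fderiv_const_apply, map_zero]

/-- Add one bubble per cell of `Λ`. Bubbles are supported in disjoint open cells, so each new one
leaves the other cells untouched. -/
theorem exists_correction (d p : ℕ) : ∃ C : ℝ, 0 ≤ C ∧
    ∀ (Ω : Set (EuclideanSpace ℝ (Fin d))) (T : RectMesh Ω) (h : ℝ), 0 < h →
    (∀ K ∈ T.cells, ∀ i, h ≤ K.upper i - K.lower i) → ∀ (f : L2 Ω) (Λ : Finset (Rect d)),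
    Λ ⊆ T.cells → ∃ z ∈ H10 Ω, ∀ L ∈ T.cells,
      (L ∉ Λ → z.fst =ᵐ[volume.restrict L.inner] (fun _ => 0) ∧
        z.snd =ᵐ[volume.restrict L.inner] fun _ => 0) ∧
      (L ∈ Λ → (∀ q ∈ MvPolynomial.restrictDegree (Fin d) ℝ p,
        ∫ x in L.inner, z.fst x * MvPolynomial.eval (fun i => x i) q =
          ∫ x in L.inner, f x * MvPolynomial.eval (fun i => x i) q) ∧
        ∫ x in L.inner, ‖z.snd x‖ ^ 2 ≤ (C * h⁻¹) ^ 2 * ∫ x in L.inner, f x ^ 2) := by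
  classical
  obtain ⟨C, hC, hbub⟩ := exists_bubble d p
  refine ⟨C, hC, fun Ω T h hh hT f Λ => ?_⟩
  induction Λ using Finset.induction_on with
  | empty =>
    intro _
    refine ⟨0, zero_mem _, fun L hL => ⟨fun _ => ⟨?_, ?_⟩, fun h => absurd h (by simp)⟩⟩
    · exact ae_mono (T.restrict_inner_le hL) (Lp.coeFn_zero ℝ 2 (volume.restrict Ω))
    · exact ae_mono (T.restrict_inner_le hL)
        (Lp.coeFn_zero (EuclideanSpace ℝ (Fin d)) 2 (volume.restrict Ω))
  | insert K Λ hKΛ ih =>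
    intro hΛ
    rw [Finset.insert_subset_iff] at hΛ
    obtain ⟨z, hz, hzL⟩ := ih hΛ.2
    have hK := hΛ.1
    obtain ⟨b, hb, hbq, hbn⟩ := hbub K h hh (hT K hK) f
      ((Lp.memLp f).mono_measure (T.restrict_inner_le hK))
    obtain ⟨y, hy, hy1, hy2⟩ := exists_pair_of_testFunction (T.inner_subset K hK) hb
    have a1 : ∀ L ∈ T.cells, ∀ᵐ x ∂volume.restrict L.inner,
        (z + y).fst x = z.fst x + b x ∧ (z + y).snd x = z.snd x + ∇ b x := by
      intro L hL
      apply ae_mono (T.restrict_inner_le hL)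
      filter_upwards [Lp.coeFn_add z.fst y.fst, Lp.coeFn_add z.snd y.snd, hy1, hy2]
        with x h1 h2 h3 h4
      exact ⟨h1.trans (by rw [Pi.add_apply, h3]), h2.trans (by rw [Pi.add_apply, h4])⟩
    have hb0 : ∀ L ∈ T.cells, L ≠ K → ∀ x ∈ L.inner, x ∉ tsupport b := fun L hL hLK x hx hxb =>
      disjoint_left.1 (T.inner_disjoint L hL K hK hLK) hx (hb.2.2 hxb)
    have a2 : ∀ L ∈ T.cells, L ≠ K → ∀ᵐ x ∂volume.restrict L.inner,
        (z + y).fst x = z.fst x ∧ (z + y).snd x = z.snd x := by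
      intro L hL hLK
      filter_upwards [a1 L hL, ae_restrict_mem L.isOpen_inner.measurableSet] with x h1 h2
      have h3 := hb0 L hL hLK x h2
      rw [h1.1, h1.2, image_eq_zero_of_notMem_tsupport h3,
        gradient_eq_zero_of_notMem_tsupport h3, add_zero, add_zero]
      exact ⟨rfl, rfl⟩
    refine ⟨z + y, add_mem hz hy, fun L hL => ⟨fun hLΛ => ?_, fun hLΛ => ?_⟩⟩
    · rw [Finset.mem_insert, not_or] at hLΛ
      have h1 := (hzL L hL).1 hLΛ.2
      constructor
      · filter_upwards [a2 L hL hLΛ.1, h1.1] with x h2 h3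
        rw [h2.1, h3]
      · filter_upwards [a2 L hL hLΛ.1, h1.2] with x h2 h3
        rw [h2.2, h3]
    · by_cases hLK : L = K
      · subst hLK
        have h1 := (hzL L hL).1 hKΛ
        constructor
        · intro q hq
          rw [← hbq q hq]
          apply integral_congr_ae
          filter_upwards [a1 L hL, h1.1] with x h2 h3
          rw [h2.1, h3, zero_add]
        · refine le_trans (le_of_eq ?_) hbn
          apply integral_congr_ae
          filter_upwards [a1 L hL, h1.2] with x h2 h3
          rw [h2.2, h3, zero_add]
      · have h1 := (hzL L hL).2 ((Finset.mem_insert.1 hLΛ).resolve_left hLK)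
        constructor
        · intro q hq
          rw [← h1.1 q hq]
          apply integral_congr_ae
          filter_upwards [a2 L hL hLK] with x h2
          rw [h2.1]
        · refine le_trans (le_of_eq ?_) h1.2
          apply integral_congr_ae
          filter_upwards [a2 L hL hLK] with x h2
          rw [h2.2]

theorem norm_add_sub_sq_le {F : Type*} [SeminormedAddCommGroup F] (a b c : F) :
    ‖a + b - c‖ ^ 2 ≤ 3 * (‖a‖ ^ 2 + ‖b‖ ^ 2 + ‖c‖ ^ 2) := by
  have h1 : ‖a + b - c‖ ≤ ‖a‖ + ‖b‖ + ‖c‖ :=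
    (norm_sub_le _ _).trans (by gcongr; exact norm_add_le _ _)
  have h2 : ‖a + b - c‖ ^ 2 ≤ (‖a‖ + ‖b‖ + ‖c‖) ^ 2 := by gcongr
  nlinarith [sq_nonneg (‖a‖ - ‖b‖), sq_nonneg (‖b‖ - ‖c‖), sq_nonneg (‖a‖ - ‖c‖)]

/-- The cutoff of a function in `W`, corrected to lie in `W` again. -/
theorem exists_cutoff_kernelSpace (d p : ℕ) : ∃ C : ℝ, 0 ≤ C ∧
    ∀ (Ω : Set (EuclideanSpace ℝ (Fin d))) (T : RectMesh Ω) (h D M : ℝ), 0 < h →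
    (∀ K ∈ T.cells, ∀ i, h ≤ K.upper i - K.lower i) →
    (∀ K ∈ T.cells, Metric.diam K.closed ≤ D) →
    ∀ (S S' : Finset (Rect d)) (η : EuclideanSpace ℝ (Fin d) → ℝ), ContDiff ℝ ∞ η →
    (∀ x, |η x| ≤ 1) → (∀ x, ‖∇ η x‖ ≤ M) → (∀ L ∈ S, ∀ x ∈ L.inner, η x = 0) →
    (∀ L ∈ T.cells, L ∉ S' → ∀ x ∈ L.inner, η x = 1) →
    ∀ ψ ∈ T.kernelSpace p, ∃ w ∈ T.kernelSpace p, ∀ L ∈ T.cells,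
      (L ∈ S → w.fst =ᵐ[volume.restrict L.inner] (fun _ => 0) ∧
        w.snd =ᵐ[volume.restrict L.inner] fun _ => 0) ∧
      (L ∉ S → L ∉ S' → w.snd =ᵐ[volume.restrict L.inner] ψ.snd) ∧
      (L ∉ S → L ∈ S' → ∫ x in L.inner, ‖w.snd x‖ ^ 2 ≤
        3 * (1 + M ^ 2 * (2 ^ d * D ^ 2) + (C * h⁻¹) ^ 2 * (2 ^ d * D ^ 2)) *
          ∫ x in L.inner, ‖ψ.snd x‖ ^ 2) := by
  classical
  obtain ⟨C, hC, hcor⟩ := exists_correction d p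
  refine ⟨C, hC, fun Ω T h D M hh hT hD S S' η hη hη1 hηM hS hS' ψ hψ => ?_⟩
  have hψ' := T.mem_kernelSpace_iff.1 hψ
  obtain ⟨u, hu, hu1, hu2⟩ := exists_smul_mem_H10 hη hη1 hηM hψ'.1
  -- Only cells in the transition band need repair: elsewhere `η ψ` is zero or equals `ψ`, and its
  -- moments already vanish.
  obtain ⟨z, hz, hzL⟩ := hcor Ω T h hh hT u.fst
    (T.cells.filter fun L => L ∉ S ∧ L ∈ S') (Finset.filter_subset _ _)
  have hws : ∀ L ∈ T.cells, ∀ᵐ x ∂volume.restrict L.inner,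
      (u - z).fst x = η x * ψ.fst x - z.fst x ∧
        (u - z).snd x = η x • ψ.snd x + ψ.fst x • ∇ η x - z.snd x := by
    intro L hL
    apply ae_mono (T.restrict_inner_le hL)
    filter_upwards [Lp.coeFn_sub u.fst z.fst, Lp.coeFn_sub u.snd z.snd, hu1, hu2]
      with x h1 h2 h3 h4
    exact ⟨h1.trans (by rw [Pi.sub_apply, h3]), h2.trans (by rw [Pi.sub_apply, h4])⟩
  have hS0 : ∀ L ∈ T.cells, L ∈ S → ∀ᵐ x ∂volume.restrict L.inner,
      (u - z).fst x = 0 ∧ (u - z).snd x = 0 := by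
    intro L hL hLS
    have h1 := (hzL L hL).1 fun hf => (Finset.mem_filter.1 hf).2.1 hLS
    filter_upwards [hws L hL, h1.1, h1.2, ae_restrict_mem L.isOpen_inner.measurableSet]
      with x h2 h3 h4 h5
    rw [h2.1, h2.2, h3, h4, hS L hLS x h5,
      gradient_eq_zero_of_eqOn_const L.isOpen_inner (hS L hLS) h5]
    simp
  have hS1 : ∀ L ∈ T.cells, L ∉ S' → ∀ᵐ x ∂volume.restrict L.inner,
      (u - z).fst x = ψ.fst x ∧ (u - z).snd x = ψ.snd x := by
    intro L hL hLS
    have h1 := (hzL L hL).1 fun hf => hLS (Finset.mem_filter.1 hf).2.2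
    filter_upwards [hws L hL, h1.1, h1.2, ae_restrict_mem L.isOpen_inner.measurableSet]
      with x h2 h3 h4 h5
    rw [h2.1, h2.2, h3, h4, hS' L hL hLS x h5,
      gradient_eq_zero_of_eqOn_const L.isOpen_inner (hS' L hL hLS) h5]
    simp
  have hw : u - z ∈ T.kernelSpace p := by
    refine T.mem_kernelSpace_iff.2 ⟨sub_mem hu hz, fun L hL q hq => ?_⟩
    by_cases h1 : L ∈ S
    · rw [← integral_zero (EuclideanSpace ℝ (Fin d)) ℝ]
      apply integral_congr_ae
      filter_upwards [hS0 L hL h1] with x hx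
      rw [hx.1, zero_mul]
    by_cases h2 : L ∈ S'
    · have h3 := ((hzL L hL).2 (Finset.mem_filter.2 ⟨hL, h1, h2⟩)).1 q hq
      have hq2 := memLp_indicator_polyEval L q volume
      rw [memLp_indicator_iff_restrict L.isOpen_inner.measurableSet] at hq2
      have i1 : ∀ f : L2 Ω, Integrable
          (fun x => f x * MvPolynomial.eval (fun i => x i) q) (volume.restrict L.inner) :=
        fun f => ((Lp.memLp f).mono_measure (T.restrict_inner_le hL)).integrable_mul hq2
      rw [← sub_eq_zero.2 h3.symm, ← integral_sub (i1 _) (i1 _)]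
      apply integral_congr_ae
      filter_upwards [hws L hL, ae_mono (T.restrict_inner_le hL) hu1] with x h4 h5
      rw [h4.1, h5, sub_mul]
    · rw [← hψ'.2 L hL q hq]
      apply integral_congr_ae
      filter_upwards [hS1 L hL h2] with x hx
      rw [hx.1]
  refine ⟨u - z, hw, fun L hL => ⟨fun h1 => ⟨?_, ?_⟩, fun _ h2 => ?_, fun h1 h2 => ?_⟩⟩
  · filter_upwards [hS0 L hL h1] with x hx using hx.1
  · filter_upwards [hS0 L hL h1] with x hx using hx.2
  · filter_upwards [hS1 L hL h2] with x hx using hx.2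
  · have h3 := ((hzL L hL).2 (Finset.mem_filter.2 ⟨hL, h1, h2⟩)).2
    have iψ : Integrable (fun x => ‖ψ.snd x‖ ^ 2) (volume.restrict L.inner) :=
      (integrable_norm_sq ψ.snd).mono_measure (T.restrict_inner_le hL)
    have iψ1 : Integrable (fun x => ψ.fst x ^ 2) (volume.restrict L.inner) := by
      have := (integrable_norm_sq ψ.fst).mono_measure (T.restrict_inner_le hL)
      simpa using this
    have iz : Integrable (fun x => ‖z.snd x‖ ^ 2) (volume.restrict L.inner) :=
      (integrable_norm_sq z.snd).mono_measure (T.restrict_inner_le hL)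
    have iu : Integrable (fun x => u.fst x ^ 2) (volume.restrict L.inner) := by
      have := (integrable_norm_sq u.fst).mono_measure (T.restrict_inner_le hL)
      simpa using this
    have iw : Integrable (fun x => ‖(u - z).snd x‖ ^ 2) (volume.restrict L.inner) :=
      (integrable_norm_sq (u - z).snd).mono_measure (T.restrict_inner_le hL)
    have h4 : ∫ x in L.inner, u.fst x ^ 2 ≤ ∫ x in L.inner, ψ.fst x ^ 2 := by
      refine integral_mono_ae iu iψ1 ?_
      filter_upwards [ae_mono (T.restrict_inner_le hL) hu1] with x hx
      rw [hx, mul_pow]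
      exact mul_le_of_le_one_left (sq_nonneg _) ((sq_le_one_iff_abs_le_one _).2 (hη1 x))
    have h5 : ∫ x in L.inner, ψ.fst x ^ 2 ≤
        (2 ^ d * D ^ 2) * ∫ x in L.inner, ‖ψ.snd x‖ ^ 2 := by
      refine (T.poincare_kernelSpace hψ hL).trans ?_
      have h6 : 0 ≤ ∫ x in L.inner, ‖ψ.snd x‖ ^ 2 := integral_nonneg fun x => by positivity
      have h7 := hD L hL
      have h8 : 0 ≤ Metric.diam L.closed := Metric.diam_nonneg
      gcongr
    have h6 : ∫ x in L.inner, ‖(u - z).snd x‖ ^ 2 ≤ ∫ x in L.inner,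
        3 * (‖ψ.snd x‖ ^ 2 + M ^ 2 * ψ.fst x ^ 2 + ‖z.snd x‖ ^ 2) := by
      refine integral_mono_ae iw (((iψ.add (iψ1.const_mul _)).add iz).const_mul _) ?_
      filter_upwards [hws L hL] with x hx
      rw [hx.2]
      refine (norm_add_sub_sq_le _ _ _).trans ?_
      rw [norm_smul, norm_smul, mul_pow, mul_pow, Real.norm_eq_abs, Real.norm_eq_abs,
        sq_abs (ψ.fst x)]
      have h7 : |η x| ^ 2 * ‖ψ.snd x‖ ^ 2 ≤ ‖ψ.snd x‖ ^ 2 :=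
        mul_le_of_le_one_left (sq_nonneg _) (pow_le_one₀ (abs_nonneg _) (hη1 x))
      have h8 : ψ.fst x ^ 2 * ‖∇ η x‖ ^ 2 ≤ M ^ 2 * ψ.fst x ^ 2 := by
        rw [mul_comm]
        have := hηM x
        gcongr
      linarith
    have iMψ := iψ1.const_mul (M ^ 2)
    have iadd : Integrable (fun x => ‖ψ.snd x‖ ^ 2 + M ^ 2 * ψ.fst x ^ 2)
        (volume.restrict L.inner) := iψ.add iMψ
    -- Both the `∇ η` term and the bubble term are reduced to the `L²` norm of `ψ` on the cell,
    -- which Poincaré's inequality bounds by its gradient.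
    rw [integral_const_mul, integral_add iadd iz, integral_add iψ iMψ,
      integral_const_mul] at h6
    have h9 := mul_le_mul_of_nonneg_left (h4.trans h5) (sq_nonneg (C * h⁻¹))
    have h10 := mul_le_mul_of_nonneg_left h5 (sq_nonneg M)
    linarith

/-! ### Decay of the energy -/

/-- The energy of the gradient in the cells outside `S`. -/
noncomputable def RectMesh.energyOff (T : RectMesh Ω) (ψ : L2Pair Ω) (S : Finset (Rect d)) : ℝ :=
  open Classical in ∑ K ∈ T.cells with K ∉ S, ∫ x in K.inner, ‖ψ.snd x‖ ^ 2

theorem cell_energy_nonneg (ψ : L2Pair Ω) (K : Rect d) : 0 ≤ ∫ x in K.inner, ‖ψ.snd x‖ ^ 2 :=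
  integral_nonneg fun x => by positivity

theorem RectMesh.energyOff_nonneg (T : RectMesh Ω) (ψ : L2Pair Ω) (S : Finset (Rect d)) :
    0 ≤ T.energyOff ψ S := Finset.sum_nonneg fun K _ => cell_energy_nonneg ψ K

theorem RectMesh.energyOff_anti (T : RectMesh Ω) (ψ : L2Pair Ω) {S S' : Finset (Rect d)}
    (h : S ⊆ S') : T.energyOff ψ S' ≤ T.energyOff ψ S := by
  classical
  refine Finset.sum_le_sum_of_subset_of_nonneg ?_ fun K _ _ => cell_energy_nonneg ψ K
  intro K hK
  rw [Finset.mem_filter] at hK ⊢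
  exact ⟨hK.1, fun h' => hK.2 (h h')⟩

theorem RectMesh.energyOff_sub (T : RectMesh Ω) (ψ : L2Pair Ω) {S S' : Finset (Rect d)}
    (h : S ⊆ S') [DecidablePred fun K : Rect d => K ∉ S ∧ K ∈ S'] :
    ∑ K ∈ T.cells with K ∉ S ∧ K ∈ S', ∫ x in K.inner, ‖ψ.snd x‖ ^ 2 =
      T.energyOff ψ S - T.energyOff ψ S' := by
  classical
  rw [eq_sub_iff_add_eq, RectMesh.energyOff, RectMesh.energyOff, ← Finset.sum_union]
  · refine Finset.sum_congr ?_ fun _ _ => rfl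
    ext K
    simp only [Finset.mem_union, Finset.mem_filter]
    have := @h K
    tauto
  · rw [Finset.disjoint_filter]
    tauto

theorem RectMesh.energyOff_le (T : RectMesh Ω) (ψ : L2Pair Ω) (S : Finset (Rect d)) :
    T.energyOff ψ S ≤ ∫ x in Ω, ‖ψ.snd x‖ ^ 2 := by
  classical
  rw [T.integral_eq_sum (integrable_norm_sq ψ.snd)]
  exact Finset.sum_le_sum_of_subset_of_nonneg (Finset.filter_subset _ _)
    fun K _ _ => cell_energy_nonneg ψ K

/-- Cells of `S` contribute nothing, and the other cells are counted in full. -/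
theorem RectMesh.setIntegral_diff_cellUnion_le (T : RectMesh Ω) (ψ : L2Pair Ω)
    (S : Finset (Rect d)) :
    ∫ x in Ω \ cellUnion S, ‖ψ.snd x‖ ^ 2 ≤ T.energyOff ψ S := by
  classical
  have hm := (isClosed_cellUnion S).measurableSet.compl
  rw [sdiff_eq, inter_comm, ← Measure.restrict_restrict hm, ← integral_indicator hm,
    T.integral_eq_sum ((integrable_norm_sq ψ.snd).indicator hm), RectMesh.energyOff,
    Finset.sum_filter]
  refine Finset.sum_le_sum fun K hK => ?_
  by_cases h : K ∈ S
  · rw [if_neg (not_not.2 h)]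
    refine le_of_eq ?_
    rw [← integral_zero (EuclideanSpace ℝ (Fin d)) ℝ]
    refine setIntegral_congr_fun K.isOpen_inner.measurableSet fun x hx => ?_
    exact indicator_of_notMem
      (notMem_compl_iff.2 (mem_cellUnion.2 ⟨K, h, K.inner_subset_closed hx⟩)) _
  · rw [if_pos h]
    refine integral_mono_ae (((integrable_norm_sq ψ.snd).indicator hm).mono_measure
      (T.restrict_inner_le hK)) ((integrable_norm_sq ψ.snd).mono_measure (T.restrict_inner_le hK))
      (Filter.Eventually.of_forall fun x => ?_)
    exact indicator_le_self' (fun _ _ => by positivity) x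

/-- Cauchy–Schwarz on a single cell; the loss stays on that cell, so summing over the band gives
exactly the energy of the band. -/
theorem IsCoefficient.abs_setIntegral_le {α β : ℝ} {A : EuclideanSpace ℝ (Fin d) → ℝ}
    (hA : IsCoefficient Ω α β A) (hα : 0 < α) (hβ : 0 ≤ β)
    {K : Rect d} (hK : volume.restrict K.inner ≤ volume.restrict Ω) (u w : L2Pair Ω) {Q : ℝ}
    (hw : ∫ x in K.inner, ‖w.snd x‖ ^ 2 ≤ Q ^ 2 * ∫ x in K.inner, ‖u.snd x‖ ^ 2) (hQ : 0 ≤ Q) :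
    |∫ x in K.inner, A x * inner ℝ (u.snd x) (w.snd x)| ≤
      β * Q * ∫ x in K.inner, ‖u.snd x‖ ^ 2 := by
  have hu2 := (Lp.memLp u.snd).mono_measure hK
  have hw2 := (Lp.memLp w.snd).mono_measure hK
  have hAK := ae_mono hK (hA.abs_le hα)
  have hAm : MemLp (fun x => A x • u.snd x) 2 (volume.restrict K.inner) :=
    hu2.of_le_mul ((hA.aesm.mono_measure hK).smul hu2.aestronglyMeasurable) (c := β) (by
      filter_upwards [hAK] with x hx
      rw [norm_smul]
      gcongr)
  have h2 := sq_integral_inner_le hAm hw2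
  simp only [real_inner_smul_left] at h2
  have h3 : ∫ x in K.inner, ‖A x • u.snd x‖ ^ 2 ≤ β ^ 2 * ∫ x in K.inner, ‖u.snd x‖ ^ 2 := by
    rw [← integral_const_mul]
    refine integral_mono_ae (hAm.integrable_norm_pow (by norm_num))
      ((hu2.integrable_norm_pow (by norm_num)).const_mul _) ?_
    filter_upwards [hAK] with x hx
    rw [norm_smul, mul_pow]
    gcongr
  have h0 := cell_energy_nonneg u K
  apply abs_le_of_sq_le_sq _ (by positivity)
  refine h2.trans ((mul_le_mul h3 hw (cell_energy_nonneg w K) (by positivity)).trans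
    (le_of_eq (by ring)))

/-- The Caccioppoli step: `a(ψ, w) = 0`, the exterior of `S'` enters with coercivity, and only the
band `S' \ S` can compensate it. -/
theorem RectMesh.energyOff_step (T : RectMesh Ω) {p : ℕ} {α β : ℝ} (hα : 0 < α) (hβ : 0 ≤ β)
    {A : EuclideanSpace ℝ (Fin d) → ℝ} (hA : IsCoefficient Ω α β A) {G : Rect d}
    (hG : G ∈ T.cells) {v : L2 Ω} {ψ : L2Pair Ω} (hψ : T.IsEnrichedCorrection p A G v ψ)
    {S S' : Finset (Rect d)} (hGS : G ∈ S) (hSS' : S ⊆ S') {w : L2Pair Ω}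
    (hw : w ∈ T.kernelSpace p) {Q : ℝ} (hQ : 0 ≤ Q)
    (hwS : ∀ L ∈ T.cells,
      (L ∈ S → w.fst =ᵐ[volume.restrict L.inner] (fun _ => 0) ∧
        w.snd =ᵐ[volume.restrict L.inner] fun _ => 0) ∧
      (L ∉ S → L ∉ S' → w.snd =ᵐ[volume.restrict L.inner] ψ.snd) ∧
      (L ∉ S → L ∈ S' → ∫ x in L.inner, ‖w.snd x‖ ^ 2 ≤
        Q ^ 2 * ∫ x in L.inner, ‖ψ.snd x‖ ^ 2)) :
    α * T.energyOff ψ S' ≤ β * Q * (T.energyOff ψ S - T.energyOff ψ S') := by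
  classical
  have h0 : energyForm A ψ w = 0 := by
    rw [hψ.2 w hw, neg_eq_zero, Measure.restrict_congr_set (T.inter_closed_ae_eq hG),
      ← integral_zero (EuclideanSpace ℝ (Fin d)) ℝ]
    apply integral_congr_ae
    filter_upwards [((hwS G hG).1 hGS).1] with x hx
    rw [hx, mul_zero]
  rw [energyForm, T.integral_eq_sum (hA.integrable hα ψ w)] at h0
  rw [← T.energyOff_sub ψ hSS', RectMesh.energyOff, Finset.mul_sum, Finset.mul_sum,
    Finset.sum_filter, Finset.sum_filter, ← sub_nonpos, ← Finset.sum_sub_distrib]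
  -- The claim is now a comparison with `a(ψ, w) = 0`, cell by cell in three cases: inside `S`, in
  -- the band, outside `S'`.
  refine le_trans (Finset.sum_le_sum fun L hL => ?_) h0.le
  by_cases h1 : L ∈ S
  · have h2 : ∫ x in L.inner, A x * inner ℝ (ψ.snd x) (w.snd x) = 0 := by
      rw [← integral_zero (EuclideanSpace ℝ (Fin d)) ℝ]
      apply integral_congr_ae
      filter_upwards [((hwS L hL).1 h1).2] with x hx
      rw [hx, inner_zero_right, mul_zero]
    rw [h2, if_neg (fun h => h (hSS' h1)), if_neg (fun h => h.1 h1), sub_zero]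
  by_cases h2 : L ∈ S'
  · rw [if_neg (fun h => h h2), if_pos ⟨h1, h2⟩, zero_sub]
    exact (abs_le.1 (hA.abs_setIntegral_le hα hβ (T.restrict_inner_le hL) ψ w
      ((hwS L hL).2.2 h1 h2) hQ)).1
  · rw [if_pos h2, if_neg (fun h => h2 h.2), sub_zero, ← integral_const_mul]
    refine integral_mono_ae
      (((integrable_norm_sq ψ.snd).mono_measure (T.restrict_inner_le hL)).const_mul _)
      ((hA.integrable hα ψ w).mono_measure (T.restrict_inner_le hL)) ?_
    filter_upwards [(hwS L hL).2.1 h1 h2, ae_mono (T.restrict_inner_le hL) hA.bounds] with x h3 h4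
    rw [h3, real_inner_self_eq_norm_sq]
    exact mul_le_mul_of_nonneg_right h4.1 (by positivity)

/-- Round `k` down to a multiple of `r`; the incomplete block of layers costs the factor `q⁻¹`. -/
theorem le_exp_of_geometric {E : ℕ → ℝ} {q : ℝ} (hq0 : 0 < q) (hq1 : q < 1) {r : ℕ} (hr : 0 < r)
    (hanti : Antitone E) (hE0 : 0 ≤ E 0) (hstep : ∀ m, E (m + r) ≤ q * E m) (k : ℕ) :
    E k ≤ q⁻¹ * Real.exp (Real.log q / r * k) * E 0 := by
  have h1 : ∀ j, E (j * r) ≤ q ^ j * E 0 := by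
    intro j
    induction j with
    | zero => simp
    | succ j ih =>
      rw [Nat.succ_mul]
      refine (hstep _).trans ?_
      rw [pow_succ', mul_assoc]
      exact mul_le_mul_of_nonneg_left ih hq0.le
  refine (hanti (Nat.div_mul_le_self k r)).trans ((h1 _).trans ?_)
  refine mul_le_mul_of_nonneg_right ?_ hE0
  rw [← Real.exp_log hq0, ← Real.exp_nat_mul, ← Real.exp_neg, ← Real.exp_add, Real.exp_log hq0]
  apply Real.exp_le_exp.2
  have hlog := Real.log_neg hq0 hq1
  have hr' : (0 : ℝ) < r := by exact_mod_cast hr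
  have h2 : (k : ℝ) / r ≤ (k / r : ℕ) + 1 := by
    rw [div_le_iff₀ hr']
    have h3 := Nat.lt_div_mul_add hr (a := k)
    have h4 : k ≤ (k / r + 1) * r := by rw [add_mul, one_mul]; exact h3.le
    exact_mod_cast h4
  have h3 : Real.log q / r * k = Real.log q * (k / r) := by ring
  rw [h3]
  nlinarith

/-! ### Mesh constants and uniform contraction -/

theorem RectMesh.ShapeRegular.pos {T : RectMesh Ω} {σ : ℝ} (hT : T.ShapeRegular σ) (hd : 1 ≤ d)
    {K : Rect d} (hK : K ∈ T.cells) : 0 < σ := by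
  have h1 := sub_pos.2 (K.lower_lt_upper ⟨0, hd⟩)
  have h2 := hT K hK ⟨0, hd⟩
  have h3 := K.side_le_diam ⟨0, hd⟩
  exact pos_of_mul_pos_left (by linarith) h1.le

theorem RectMesh.QuasiUniform.pos {T : RectMesh Ω} {κ H : ℝ} (hT : T.QuasiUniform κ H)
    (hH : 0 < H) {K : Rect d} (hK : K ∈ T.cells) : 0 < κ :=
  pos_of_mul_pos_left (hH.trans_le (hT K hK).2) Metric.diam_nonneg

theorem RectMesh.div_le_side {T : RectMesh Ω} {σ κ H : ℝ} (hσ : 0 < σ) (hκ : 0 < κ)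
    (hT : T.ShapeRegular σ) (hT' : T.QuasiUniform κ H) {K : Rect d} (hK : K ∈ T.cells)
    (i : Fin d) : H / (κ * σ) ≤ K.upper i - K.lower i := by
  rw [div_le_iff₀ (by positivity)]
  calc H ≤ κ * Metric.diam K.closed := (hT' K hK).2
    _ ≤ κ * (σ * (K.upper i - K.lower i)) := by gcongr; exact hT K hK i
    _ = _ := by ring

/-- The energy outside the patches contracts every `2 * 2 ^ d + 2` layers, with a rate that only
depends on the shape regularity, the quasi-uniformity, the domain and the coefficient bounds. -/
theorem exists_contraction (hd : 1 ≤ d) (p : ℕ) (hΩb : Bornology.IsBounded Ω) {α β : ℝ}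
    (hα : 0 < α) (hβ : 0 < β) (σ κ : ℝ) :
    ∃ q : ℝ, 0 < q ∧ q < 1 ∧ ∀ A : EuclideanSpace ℝ (Fin d) → ℝ, IsCoefficient Ω α β A →
      ∀ (T : RectMesh Ω) (H : ℝ), 0 < H → T.ShapeRegular σ → T.QuasiUniform κ H →
      ∀ G ∈ T.cells, ∀ (v : L2 Ω) (ψ : L2Pair Ω), T.IsEnrichedCorrection p A G v ψ →
      ∀ m : ℕ, T.energyOff ψ (T.grow^[m + (2 * 2 ^ d + 2)] {G}) ≤
        q * T.energyOff ψ (T.grow^[m] {G}) := by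
  by_cases hne : Nonempty (RectMesh Ω) ∧ 0 < σ ∧ 0 < κ
  swap
  · refine ⟨1 / 2, by norm_num, by norm_num, fun A _ T H hH h1 h2 G hG => ?_⟩
    exact absurd ⟨⟨T⟩, h1.pos hd hG, h2.pos hH hG⟩ hne
  obtain ⟨⟨T₀⟩, hσ, hκ⟩ := hne
  obtain ⟨δ, hδ, hsep⟩ := T₀.exists_separation
  obtain ⟨C, hC, hcut⟩ := exists_cutoff_kernelSpace d p
  set D₀ := Metric.diam (closure Ω) with hD₀
  have hD₀0 : 0 ≤ D₀ := Metric.diam_nonneg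
  -- The cutoff has width `θ * H`. The first bound keeps this below all side lengths; the second,
  -- with `H ≤ κ * D₀`, keeps it below the separation `δ`. The summand one avoids division by zero.
  set θ := min (1 / (κ * σ)) (δ / (κ * (D₀ + 1))) with hθ
  have hθ0 : 0 < θ := lt_min (by positivity) (by positivity)
  -- The band constant of `exists_cutoff_kernelSpace` for side length `H / (κ * σ)`, diameter `H`
  -- and slope `2 / (θ * H)`, after cancelling `H`.
  set Q₂ := 3 * (1 + (2 / θ) ^ 2 * 2 ^ d + (C * (κ * σ)) ^ 2 * 2 ^ d) with hQ₂
  have hQ₂0 : 0 < Q₂ := by positivity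
  set Q := √Q₂ with hQ
  have hQ0 : 0 < Q := Real.sqrt_pos.2 hQ₂0
  have hβQ : 0 < β * Q := by positivity
  refine ⟨β * Q / (α + β * Q), by positivity, (div_lt_one (by positivity)).2 (by linarith), ?_⟩
  intro A hA T H hH hT hT' G hG v ψ hψ m
  have hGs : ({G} : Finset (Rect d)) ⊆ T.cells := Finset.singleton_subset_iff.2 hG
  set S := T.grow^[m] {G} with hS
  have hSc : S ⊆ T.cells := T.iterate_grow_subset_cells hGs m
  have hGS : G ∈ S := T.subset_iterate_grow hGs m (Finset.mem_singleton_self G)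
  have hS' : T.grow^[m + (2 * 2 ^ d + 2)] {G} = T.grow^[2 * 2 ^ d + 2] S := by
    rw [add_comm, Function.iterate_add_apply]
  rw [hS']
  have hside : ∀ K ∈ T.cells, ∀ i, H / (κ * σ) ≤ K.upper i - K.lower i :=
    fun K hK i => RectMesh.div_le_side hσ hκ hT hT' hK i
  have hHD : H ≤ κ * D₀ := by
    refine (hT' G hG).2.trans ?_
    gcongr
    refine Metric.diam_mono ?_ hΩb.closure
    rw [T.closure_eq]
    exact subset_biUnion_of_mem (u := fun K : Rect d => K.closed) hG
  have hθh : θ * H ≤ H / (κ * σ) := by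
    rw [div_eq_mul_one_div, mul_comm]
    gcongr
    exact min_le_left _ _
  have hθδ : θ * H ≤ δ := by
    calc θ * H ≤ δ / (κ * (D₀ + 1)) * (κ * (D₀ + 1)) := by
          gcongr
          · exact min_le_right _ _
          · nlinarith
      _ = δ := div_mul_cancel₀ _ (by positivity)
  obtain ⟨η, hη, hη1, hη0, hη1', hηg⟩ :=
    exists_smooth_cutoff (cellUnion S) (ρ := θ * H) (by positivity)
  obtain ⟨w, hw, hwS⟩ := hcut Ω T (H / (κ * σ)) H (2 / (θ * H)) (by positivity) hside
    (fun K hK => (hT' K hK).1) S (T.grow^[2 * 2 ^ d + 2] S) η hη hη1 hηg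
    (fun L hL x hx => hη0 x (mem_cellUnion.2 ⟨L, hL, L.inner_subset_closed hx⟩))
    (fun L hL hLS x hx => hη1' x (by
      by_contra! hlt
      obtain ⟨y, hy⟩ := G.closed_nonempty
      obtain ⟨s, hs, hxs⟩ := (Metric.infDist_lt_iff ⟨y, mem_cellUnion.2 ⟨G, hGS, hy⟩⟩).1 hlt
      rw [dist_comm] at hxs
      have hxΩ : x ∈ closure Ω := subset_closure (T.inner_subset L hL hx)
      have h1 := T₀.mem_iterate_grow_of_dist_lt T hsep hside hSc hs hxΩ
        (hxs.trans_le hθδ) (hxs.trans_le hθh)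
      apply hLS
      -- The extra layer passes from the nearby point `x` to the whole cell `L`: `x` is covered
      -- after `2 * 2 ^ d + 1` steps, so `L` touches that layer.
      rw [show 2 * 2 ^ d + 2 = (2 * 2 ^ d + 1) + 1 from rfl, Function.iterate_succ_apply']
      exact T.mem_grow.2 ⟨hL, x, h1, L.inner_subset_closed hx⟩)) ψ hψ.1
  -- All powers of `H` cancel, so the contraction rate does not depend on the mesh size.
  have hQeq : 3 * (1 + (2 / (θ * H)) ^ 2 * (2 ^ d * H ^ 2) +
      (C * (H / (κ * σ))⁻¹) ^ 2 * (2 ^ d * H ^ 2)) = Q ^ 2 := by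
    rw [hQ, Real.sq_sqrt hQ₂0.le, hQ₂]
    field_simp
  rw [hQeq] at hwS
  have hstep := T.energyOff_step hα hβ.le hA hG hψ hGS
    (T.subset_iterate_grow hSc (2 * 2 ^ d + 2)) hw hQ0.le hwS
  rw [div_mul_eq_mul_div, le_div_iff₀ (by positivity)]
  linarith

end LOD

/-! ### Exponential decay of the corrector -/

theorem mainTheorem4 (d : ℕ) (hd : 1 ≤ d) (p : ℕ)
    (Ω : Set (EuclideanSpace ℝ (Fin d))) (hΩo : IsOpen Ω) (hΩb : Bornology.IsBounded Ω)
    (α β : ℝ) (hα : 0 < α) (σ κ : ℝ) :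
    ∃ c C : ℝ, 0 < c ∧ 0 < C ∧
      ∀ A : EuclideanSpace ℝ (Fin d) → ℝ,
        AEStronglyMeasurable A (volume.restrict Ω) →
        (∀ᵐ x ∂volume.restrict Ω, α ≤ A x ∧ A x ≤ β) →
      ∀ (T : LOD.RectMesh Ω) (H : ℝ), 0 < H → T.ShapeRegular σ → T.QuasiUniform κ H →
      ∀ G ∈ T.cells, ∀ v : LOD.L2 Ω,
        (∃! ψ : LOD.L2Pair Ω, T.IsEnrichedCorrection p A G v ψ) ∧
        ∀ ψ : LOD.L2Pair Ω, T.IsEnrichedCorrection p A G v ψ →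
          ∀ k : ℕ, 1 ≤ k →
            LOD.gradNormOn (Ω \ T.patch k G.closed) ψ
              ≤ C * Real.exp (-c * k) * LOD.gradNormOn Ω ψ := by
  -- Enlarging `β` to `max β α` supplies a positive upper bound without assuming `α ≤ β`.
  have hβ' : 0 < max β α := lt_max_of_lt_right hα
  obtain ⟨q, hq0, hq1, hq⟩ := LOD.exists_contraction hd p hΩb hα hβ' σ κ
  have hr : (0 : ℝ) < (2 * 2 ^ d + 2 : ℕ) := by positivity
  -- The contraction concerns squared norms, so the square root halves the exponent and turns `q⁻¹`
  -- into its root.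
  refine ⟨-Real.log q / (2 * (2 * 2 ^ d + 2 : ℕ)), √(q⁻¹),
    div_pos (neg_pos.2 (Real.log_neg hq0 hq1)) (by positivity),
    Real.sqrt_pos.2 (inv_pos.2 hq0), ?_⟩
  intro A hAm hAb T H hH hT hT' G hG v
  have hA : LOD.IsCoefficient Ω α (max β α) A := by
    refine ⟨hAm, ?_⟩
    filter_upwards [hAb] with x hx
    exact ⟨hx.1, hx.2.trans (le_max_left _ _)⟩
  refine ⟨T.existsUnique_isEnrichedCorrection p hα hβ'.le hA G v, fun ψ hψ k _ => ?_⟩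
  have hGs : ({G} : Finset (LOD.Rect d)) ⊆ T.cells := Finset.singleton_subset_iff.2 hG
  have hanti : Antitone fun k => T.energyOff ψ (T.grow^[k] {G}) := by
    refine antitone_nat_of_succ_le fun k => T.energyOff_anti ψ ?_
    rw [Function.iterate_succ_apply']
    exact T.subset_grow (T.iterate_grow_subset_cells hGs k)
  have h1 := LOD.le_exp_of_geometric hq0 hq1 (Nat.succ_pos _) hanti (T.energyOff_nonneg ψ _)
    (hq A hA T H hH hT hT' G hG v ψ hψ) k
  have h2 := T.setIntegral_diff_cellUnion_le ψ (T.grow^[k] {G})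
  have h3 := T.energyOff_le ψ {G}
  rw [← T.patch_eq] at h2
  have h4 : Real.exp (-(-Real.log q / (2 * (2 * 2 ^ d + 2 : ℕ))) * k) =
      √(Real.exp (Real.log q / (2 * 2 ^ d + 2 : ℕ) * k)) := by
    rw [← Real.exp_half]
    congr 1
    field_simp
  rw [LOD.gradNormOn, LOD.gradNormOn, h4, ← Real.sqrt_mul (inv_nonneg.2 hq0.le),
    ← Real.sqrt_mul (by positivity)]
  apply Real.sqrt_le_sqrt
  refine h2.trans (h1.trans ?_)
  exact mul_le_mul_of_nonneg_left h3 (by positivity)
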